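/- **Episode-level $(\epsilon_i,\delta)$-DP guarantee for DPMAC.** Setting. There are $N$ agents; fix an agent $i$ and an episode of finite length $T$. The private data of agent $i$ are $n$ transitions $D=(x_1,\dots,x_n)\in\mathcal X^n$; two datasets are neighbouring if they differ in at most one transition. For $t=1,\dots,T$ the local trajectory $\tau_i^t$ consists of the transitions with index in a given set $J_t\subseteq\{1,\dots,n\}$ (for instance the first $t$ transitions), and $f^t$ is a (possibly stochastic) message function: it maps a finite multiset $s$ of transitions and an internal random variable $\omega$ to a vector $f^t(\omega,s)\in\mathbb R^d$, measurably in $\omega$. Let $\gamma_1,\gamma_2\in(0,1)$, and let $C>0$ be such that every $f^t$ has $\ell_2$-sensitivity at most $2C$, i.e. $\|f^t(\omega,s)-f^t(\omega,s')\|_2\le 2C$ for all $\omega$ and all $s,s'$ that differ by the replacement of one element. (This holds in particular if $\|f^t\|_2\le C$, e.g. after norm clipping.) A privatized message at time $t$ is $m=f^t(\omega,s)+u$, where $s$ is the collection of transitions on a subset of $J_t$ of size $\lfloor\gamma_1|J_t|\rfloor$ drawn uniformly without replacement, $u\sim\mathcal N(0,\sigma_i^2 I_d)$, and the subset, $\omega$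 and $u$ are independent. At each time $t$ agent $i$ draws a set $K_t$ of $\lfloor\gamma_2N\rfloor$ other agents uniformly without replacement, independently of everything else, and sends to each agent in $K_t$ a privatized message; either (a) the messages to different agents are generated independently of each other, or (b) one single privatized message is sent to all agents in $K_t$. Different time steps use independent randomness. The communication of agent $i$ in the whole episode is the output consisting of all sets $K_t$ and all messages sent, $t=1,\dots,T$. Claim. Let $\epsilon_i>0$, $\delta>0$, $\beta\in(0,1)$, and put $$\alpha=\frac{\log\delta^{-1}}{\epsilon_i(1-\beta)}+1,\qquad \sigma_i^2=\frac{14\,\gamma_2\gamma_1^2NC^2\alpha T}{\beta\epsilon_i},\qquad \sigma'^2=\frac{\sigma_i^2}{4C^2}.$$ If $\sigma'^2\ge 0.7$ and $$\alpha\le\frac{2\sigma'^2}{3}\log\frac{1}{\gamma_1\alpha(1+\sigma'^2)}+1,$$ then, both in case (a) and in case (b), the communication of agent $i$ in the whole episode is $(\epsilon_i,\delta)$-differentially private: for all neighbouring datasets $D,D'$ and every measurable set $S$ of outputs, $\Pr[M(D)\in S]\le e^{\epsilon_i}\Pr[M(D')\in S]+\delta$. -/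

import Mathlib

open MeasureTheory ProbabilityTheory
open scoped ENNReal

namespace DPMAC

noncomputable section

/-- Two datasets of `n` records are neighbouring if they differ in at most one record. -/
def Neighbouring {n : ℕ} {X : Type*} (D D' : Fin n → X) : Prop :=
  ∃ j : Fin n, ∀ l : Fin n, l ≠ j → D l = D' l

/-- Two finite samples (multisets of records) are neighbouring if they have the same size and one
is obtained from the other by replacing one record. -/
def NeighbouringSamples {X : Type*} (s s' : Multiset X) : Prop :=
  ∃ (r : Multiset X) (a b : X), s = a ::ₘ r ∧ s' = b ::ₘ r

/-- A randomized mechanism, given by the law `M D` of its output on each dataset `D`, is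
`(ε, δ)`-differentially private. -/
def IsDP {n : ℕ} {X Y : Type*} [MeasurableSpace Y] (M : (Fin n → X) → Measure Y) (ε δ : ℝ) :
    Prop :=
  (∀ D, IsProbabilityMeasure (M D)) ∧
    ∀ D D' : Fin n → X, Neighbouring D D' → ∀ S : Set Y, MeasurableSet S →
      M D S ≤ ENNReal.ofReal (Real.exp ε) * M D' S + ENNReal.ofReal δ

/-- The law obtained by drawing `a` uniformly from the finite set `A` and then drawing from
`μ a`. -/
def uniformMixture {A Y : Type*} [MeasurableSpace Y] (s : Finset A) (μ : A → Measure Y) :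
    Measure Y :=
  (s.card : ℝ≥0∞)⁻¹ • ∑ a ∈ s, μ a

/-- The `ℓ²`-sensitivity of a (possibly stochastic) message function. `f ω s` is the message
generated from the sample `s` with internal randomness `ω`; a deterministic message function does
not depend on `ω`. -/
def l2Sensitivity {Ω X : Type*} {d : ℕ} (f : Ω → Multiset X → EuclideanSpace ℝ (Fin d)) : ℝ≥0∞ :=
  ⨆ (ω : Ω) (s : Multiset X) (s' : Multiset X) (_ : NeighbouringSamples s s'),
    edist (f ω s) (f ω s')

/-- The law of one privatized message `m = p + u`: a subset `S` of `⌊γ₁ |J|⌋` records is drawn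
uniformly without replacement from the local trajectory, which consists of the records of `D` with
index in `J`; then `p = f ω (D restricted to S)` with `ω ∼ ν`, and `u ∼ N(0, v I_d)`
independently. -/
def messageLaw {Ω X : Type*} [MeasurableSpace Ω] {n d : ℕ} (γ₁ v : ℝ) (ν : Measure Ω)
    (f : Ω → Multiset X → EuclideanSpace ℝ (Fin d)) (J : Finset (Fin n)) (D : Fin n → X) :
    Measure (EuclideanSpace ℝ (Fin d)) :=
  uniformMixture (J.powersetCard ⌊γ₁ * (J.card : ℝ)⌋₊) fun S =>
    (ν.prod (multivariateGaussian (0 : EuclideanSpace ℝ (Fin d))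
      (v • (1 : Matrix (Fin d) (Fin d) ℝ)))).map fun p => f p.1 (S.val.map D) + p.2

/-- What an agent sends at one step: the set of recipients, and the message to each of them. -/
abbrev Transcript (N d : ℕ) : Type :=
  Σ K : Finset (Fin N), (K → EuclideanSpace ℝ (Fin d))

/-- The possible recipient sets of agent `i`: the sets of `⌊γ₂ N⌋` agents other than `i`. -/
def recipientSets {N : ℕ} (γ₂ : ℝ) (i : Fin N) : Finset (Finset (Fin N)) :=
  (Finset.univ.erase i).powersetCard ⌊γ₂ * (N : ℝ)⌋₊

/-- One communication step in which each recipient gets its own message, all generated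
independently (own sample of the trajectory, own internal randomness, own noise). -/
def stepFresh {N d : ℕ} (γ₂ : ℝ) (i : Fin N) (μ : Measure (EuclideanSpace ℝ (Fin d))) :
    Measure (Transcript N d) :=
  uniformMixture (recipientSets γ₂ i) fun K =>
    (Measure.pi fun _ : K => μ).map (Sigma.mk K)

/-- One communication step in which a single message is generated and shared with all
recipients. -/
def stepShared {N d : ℕ} (γ₂ : ℝ) (i : Fin N) (μ : Measure (EuclideanSpace ℝ (Fin d))) :
    Measure (Transcript N d) :=
  uniformMixture (recipientSets γ₂ i) fun K =>
    μ.map fun m => (⟨K, fun _ => m⟩ : Transcript N d)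

/-- The communication of agent `i` over an episode of `T` steps, each recipient getting its own
message. At step `t` the message function is `f t` and the local trajectory is indexed by `τ t`. -/
def episodeFresh {Ω X : Type*} [MeasurableSpace Ω] {N n d T : ℕ} (γ₁ γ₂ v : ℝ) (ν : Measure Ω)
    (i : Fin N) (f : Fin T → Ω → Multiset X → EuclideanSpace ℝ (Fin d))
    (τ : Fin T → Finset (Fin n)) (D : Fin n → X) : Measure (Fin T → Transcript N d) :=
  Measure.pi fun t => stepFresh γ₂ i (messageLaw γ₁ v ν (f t) (τ t) D)

/-- The communication of agent `i` over an episode of `T` steps, one message per step being shared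
with all recipients of that step. -/
def episodeShared {Ω X : Type*} [MeasurableSpace Ω] {N n d T : ℕ} (γ₁ γ₂ v : ℝ) (ν : Measure Ω)
    (i : Fin N) (f : Fin T → Ω → Multiset X → EuclideanSpace ℝ (Fin d))
    (τ : Fin T → Finset (Fin n)) (D : Fin n → X) : Measure (Fin T → Transcript N d) :=
  Measure.pi fun t => stepShared γ₂ i (messageLaw γ₁ v ν (f t) (τ t) D)

end

end DPMAC

/-! Everything is measured by Rényi moments `∫ (dP/dQ)^α dQ`. They multiply over independent
outputs, and a Markov-type tail estimate turns a bound on them into approximate differential privacy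
(`RenyiBound.measure_le`). One privatized message therefore carries the main work
(`renyiBound_messageLaw`).

Let `j` be the record that changes. A uniform sample can be generated by drawing a set `R` avoiding
`j` and one more record `l`, then adding `j` to `R` with probability `γ ≤ γ₁` and `l` otherwise
(`sum_powersetCard_insert`). Given `R`, `l` and `ω`, the two message laws are `(1-γ) N(a) + γ N(b)`
and `(1-γ) N(a) + γ N(c)`, with `a, b, c` pairwise within the sensitivity. Joint convexity of `(X,
Y) ↦ Y (X/Y)^α` reduces the problem to such a pair.

For the pair, expand `Y (X/Y)^α` around `X = Y`. The linear part integrates to one, since both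
densities have mass one. As `X - Y` is `γ` times the difference of two Gaussian densities, the
quadratic part is of size `γ² x`, with `x = 4C²/σ²`. The condition on `α` makes the higher moments
sum to another multiple of `x` (`sum_momentBound_le`). The moment of one message is then at most
`exp (3.5 α (α-1) γ₁² x)`.

With at most `γ₂ N` recipients in each of `T` steps, the exponents add up to at most `(α-1) β ε`.
The remaining `(α-1)(1-β) ε` equals `log (1/δ)`, which is the price of the conversion to `(ε, δ)`.
-/

namespace DPMAC

/-! ### Rényi moments: products and conversion to approximate privacy. -/

/-- `P` has a density with respect to `Q` whose `α`-th moment under `Q` is at most `B`, i.e. the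
exponential of `α - 1` times the Rényi divergence of order `α` is at most `B`. -/
def RenyiBound {Y : Type*} [MeasurableSpace Y] (α : ℝ) (P Q : Measure Y) (B : ℝ≥0∞) : Prop :=
  ∃ g : Y → ℝ≥0∞, Measurable g ∧ P = Q.withDensity g ∧ ∫⁻ y, g y ^ α ∂Q ≤ B

lemma lintegral_pi_prod {ι : Type*} [Fintype ι] {Y : ι → Type*} [∀ i, MeasurableSpace (Y i)]
    (μ : ∀ i, Measure (Y i)) [∀ i, IsProbabilityMeasure (μ i)] {g : ∀ i, Y i → ℝ≥0∞}
    (hg : ∀ i, Measurable (g i)) :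
    ∫⁻ y, ∏ i, g i (y i) ∂Measure.pi μ = ∏ i, ∫⁻ y, g i y ∂μ i := by
  have hind : iIndepFun (fun i (y : ∀ i, Y i) => g i (y i)) (Measure.pi μ) :=
    iIndepFun_pi (X := fun i => g i) fun i => (hg i).aemeasurable
  rw [lintegral_prod_eq_prod_lintegral_of_indepFun Finset.univ _ hind
    fun i => (hg i).comp (measurable_pi_apply i)]
  refine Finset.prod_congr rfl fun i _ => ?_
  rw [← (measurePreserving_eval μ i).lintegral_comp (hg i)]

lemma pi_withDensity {ι : Type*} [Fintype ι] {Y : ι → Type*} [∀ i, MeasurableSpace (Y i)]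
    (μ : ∀ i, Measure (Y i)) [∀ i, IsProbabilityMeasure (μ i)] {g : ∀ i, Y i → ℝ≥0∞}
    (hg : ∀ i, Measurable (g i)) [∀ i, IsProbabilityMeasure ((μ i).withDensity (g i))] :
    Measure.pi (fun i => (μ i).withDensity (g i)) =
      (Measure.pi μ).withDensity fun y => ∏ i, g i (y i) := by
  refine Measure.pi_eq fun s hs => ?_
  have hbox : MeasurableSet (Set.univ.pi s) := MeasurableSet.univ_pi hs
  rw [withDensity_apply _ hbox, ← lintegral_indicator hbox]
  have : ∀ y : ∀ i, Y i, (Set.univ.pi s).indicator (fun y => ∏ i, g i (y i)) y =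
      ∏ i, (s i).indicator (g i) (y i) := by
    intro y
    by_cases hy : y ∈ Set.univ.pi s
    · rw [Set.indicator_of_mem hy]
      exact Finset.prod_congr rfl fun i _ =>
        (Set.indicator_of_mem (hy i (Set.mem_univ i)) _).symm
    · rw [Set.indicator_of_notMem hy]
      simp only [Set.mem_pi, Set.mem_univ, true_implies, not_forall] at hy
      obtain ⟨i, hi⟩ := hy
      exact (Finset.prod_eq_zero (Finset.mem_univ i) (Set.indicator_of_notMem hi _)).symm
  simp_rw [this]
  rw [lintegral_pi_prod μ fun i => (hg i).indicator (hs i)]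
  refine Finset.prod_congr rfl fun i _ => ?_
  rw [lintegral_indicator (hs i), withDensity_apply _ (hs i)]

lemma map_withDensity_comp {Y Z : Type*} [MeasurableSpace Y] [MeasurableSpace Z] (μ : Measure Y)
    {e : Y → Z} (he : Measurable e) {G : Z → ℝ≥0∞} (hG : Measurable G) :
    (μ.withDensity fun y => G (e y)).map e = (μ.map e).withDensity G := by
  ext s hs
  rw [Measure.map_apply he hs, withDensity_apply _ (he hs), withDensity_apply _ hs,
    setLIntegral_map hs hG he]

namespace RenyiBound

variable {Y : Type*} [MeasurableSpace Y] {α : ℝ} {P Q : Measure Y} {B B' : ℝ≥0∞}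

lemma mono (h : RenyiBound α P Q B) (hB : B ≤ B') : RenyiBound α P Q B' := by
  obtain ⟨g, hg, hP, hB₁⟩ := h
  exact ⟨g, hg, hP, hB₁.trans hB⟩

lemma refl (α : ℝ) (P : Measure Y) [IsProbabilityMeasure P] : RenyiBound α P P 1 :=
  ⟨1, measurable_one, by simp, by simp⟩

/-- The density of a product is the product of the densities, so its moment factorizes. This is the
composition theorem used across time steps. -/
lemma pi {ι : Type*} [Fintype ι] {Y : ι → Type*} [∀ i, MeasurableSpace (Y i)]
    {P Q : ∀ i, Measure (Y i)} [∀ i, IsProbabilityMeasure (P i)] [∀ i, IsProbabilityMeasure (Q i)]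
    {B : ι → ℝ≥0∞} (hα : 0 ≤ α) (h : ∀ i, RenyiBound α (P i) (Q i) (B i)) :
    RenyiBound α (Measure.pi P) (Measure.pi Q) (∏ i, B i) := by
  choose g hg hP hB using h
  obtain rfl : P = fun i => (Q i).withDensity (g i) := funext hP
  refine ⟨fun y => ∏ i, g i (y i), by fun_prop, pi_withDensity Q hg, ?_⟩
  simp_rw [← ENNReal.prod_rpow_of_nonneg hα]
  rw [lintegral_pi_prod Q fun i => (hg i).pow_const α]
  exact Finset.prod_le_prod' fun i _ => hB i

/-- A Rényi bound of order `α > 1` implies approximate differential privacy. -/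
lemma measure_le {ε δ : ℝ} (hα : 1 < α) (h : RenyiBound α P Q B)
    (hB : B ≤ ENNReal.ofReal (Real.exp ((α - 1) * ε) * δ)) (S : Set Y)
    (hS : MeasurableSet S) :
    P S ≤ ENNReal.ofReal (Real.exp ε) * Q S + ENNReal.ofReal δ := by
  obtain ⟨g, hg, rfl, hgB⟩ := h
  set c : ℝ≥0∞ := ENNReal.ofReal (Real.exp ε) with hc
  have hct : c ≠ ∞ := by simp [hc]
  have hcpow : c ^ (α - 1) = ENNReal.ofReal (Real.exp ((α - 1) * ε)) := by
    rw [hc, ENNReal.ofReal_rpow_of_pos (Real.exp_pos _), ← Real.exp_mul, mul_comm]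
  -- Where `g > c`, one has `g ≤ g (g/c)^(α-1)`; elsewhere the constant `c` suffices. Integrating
  -- over `S` gives the claim.
  have hpt : ∀ y, g y ≤ c + (c ^ (α - 1))⁻¹ * g y ^ α := by
    intro y
    rcases le_or_gt (g y) c with hy | hy
    · exact hy.trans le_self_add
    · refine le_trans ?_ le_add_self
      have hy0 : g y ≠ 0 := (bot_lt_of_lt hy).ne'
      rcases eq_or_ne (g y) ∞ with ht | ht
      · rw [ht, ENNReal.top_rpow_of_pos (by linarith), ENNReal.mul_top]
        exact ENNReal.inv_ne_zero.2 (ENNReal.rpow_ne_top_of_nonneg (by linarith) hct)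
      · have hsplit : g y ^ α = g y ^ (α - 1) * g y := by
          simpa using ENNReal.rpow_add (α - 1) 1 hy0 ht
        rw [hsplit, ← mul_assoc, mul_comm _ (g y ^ (α - 1)), ← div_eq_mul_inv]
        refine le_mul_of_one_le_left' ?_
        rw [ENNReal.le_div_iff_mul_le
          (Or.inl (by rw [hcpow]; simp [Real.exp_pos])) (Or.inl (by rw [hcpow]; simp)), one_mul]
        exact ENNReal.rpow_le_rpow hy.le (by linarith)
  rw [withDensity_apply _ hS]
  calc ∫⁻ y in S, g y ∂Q ≤ ∫⁻ y in S, (c + (c ^ (α - 1))⁻¹ * g y ^ α) ∂Q := lintegral_mono hpt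
    _ = c * Q S + (c ^ (α - 1))⁻¹ * ∫⁻ y in S, g y ^ α ∂Q := by
        rw [lintegral_add_left measurable_const, lintegral_const_mul _ (hg.pow_const α)]
        simp
    _ ≤ c * Q S + (c ^ (α - 1))⁻¹ * ENNReal.ofReal (Real.exp ((α - 1) * ε) * δ) := by
        gcongr
        exact (setLIntegral_le_lintegral _ _).trans (hgB.trans hB)
    _ = _ := by
        rw [ENNReal.ofReal_mul (Real.exp_pos _).le, ← hcpow, ← mul_assoc,
          ENNReal.inv_mul_cancel, one_mul]
        · rw [hcpow]; simp [Real.exp_pos]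
        · rw [hcpow]; simp

end RenyiBound

/-! ### Measurability on sigma types, and uniform mixtures. -/

lemma measurable_sigma {A Z : Type*} {Y : A → Type*} [∀ a, MeasurableSpace (Y a)]
    [MeasurableSpace Z] {G : Sigma Y → Z} (hG : ∀ a, Measurable fun y => G ⟨a, y⟩) :
    Measurable G :=
  fun _ hs => MeasurableSpace.measurableSet_iInf.2 fun a => hG a hs

lemma measurable_sigmaMk {A : Type*} {Y : A → Type*} [∀ a, MeasurableSpace (Y a)] (a : A) :
    Measurable (Sigma.mk a : Y a → Sigma Y) :=
  fun _ hs => MeasurableSpace.measurableSet_iInf.1 hs a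

section uniformMixture

variable {A Y : Type*} [MeasurableSpace Y] {s : Finset A}

lemma lintegral_uniformMixture (μ : A → Measure Y) (g : Y → ℝ≥0∞) :
    ∫⁻ y, g y ∂uniformMixture s μ = (s.card : ℝ≥0∞)⁻¹ * ∑ a ∈ s, ∫⁻ y, g y ∂μ a := by
  rw [uniformMixture, lintegral_smul_measure, lintegral_finsetSum_measure, smul_eq_mul]

lemma uniformMixture_withDensity (μ : A → Measure Y) (g : Y → ℝ≥0∞) :
    uniformMixture s (fun a => (μ a).withDensity g) = (uniformMixture s μ).withDensity g := by
  ext t ht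
  rw [withDensity_apply _ ht, uniformMixture, uniformMixture, Measure.restrict_smul,
    lintegral_smul_measure, Measure.smul_apply, Measure.finsetSum_apply,
    ← Measure.restrictₗ_apply, map_sum, lintegral_finsetSum_measure]
  simp only [Measure.restrictₗ_apply, withDensity_apply _ ht]

lemma uniformMixture_congr {μ ν : A → Measure Y} (h : ∀ a ∈ s, μ a = ν a) :
    uniformMixture s μ = uniformMixture s ν := by
  rw [uniformMixture, uniformMixture, Finset.sum_congr rfl h]

lemma inv_card_mul_sum_const (hs : s.Nonempty) (c : ℝ≥0∞) :
    (s.card : ℝ≥0∞)⁻¹ * ∑ _a ∈ s, c = c := by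
  rw [Finset.sum_const, nsmul_eq_mul, ← mul_assoc, ENNReal.inv_mul_cancel, one_mul] <;>
    simp [hs.ne_empty]

lemma isProbabilityMeasure_uniformMixture (hs : s.Nonempty) (μ : A → Measure Y)
    (hμ : ∀ a ∈ s, IsProbabilityMeasure (μ a)) : IsProbabilityMeasure (uniformMixture s μ) := by
  constructor
  rw [uniformMixture, Measure.smul_apply, Measure.finsetSum_apply, smul_eq_mul,
    Finset.sum_congr rfl fun a ha => (hμ a ha).measure_univ, inv_card_mul_sum_const hs]

end uniformMixture

/-! ### One communication step. -/

section steps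

variable {N d : ℕ} {γ₂ : ℝ}

lemma recipientSets_nonempty (hγ₂ : γ₂ ∈ Set.Ioo (0 : ℝ) 1) (i : Fin N) :
    (recipientSets γ₂ i).Nonempty := by
  rw [recipientSets, Finset.powersetCard_nonempty, Finset.card_erase_of_mem (Finset.mem_univ i),
    Finset.card_univ, Fintype.card_fin]
  have hN : 0 < N := i.pos
  have : ⌊γ₂ * (N : ℝ)⌋₊ < N := by
    rw [Nat.floor_lt (by have := hγ₂.1; positivity)]
    have : (0 : ℝ) < N := by exact_mod_cast hN
    nlinarith [hγ₂.2]
  omega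

lemma isProbabilityMeasure_stepFresh (hγ₂ : γ₂ ∈ Set.Ioo (0 : ℝ) 1) (i : Fin N)
    (μ : Measure (EuclideanSpace ℝ (Fin d))) [IsProbabilityMeasure μ] :
    IsProbabilityMeasure (stepFresh γ₂ i μ) :=
  isProbabilityMeasure_uniformMixture (recipientSets_nonempty hγ₂ i) _ fun K _ =>
    Measure.isProbabilityMeasure_map (measurable_sigmaMk K).aemeasurable

lemma measurable_messageAt (K : Finset (Fin N)) (l : K) :
    Measurable fun y : K → EuclideanSpace ℝ (Fin d) => y l :=
  measurable_pi_apply l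

lemma measurable_prod_messages {g : EuclideanSpace ℝ (Fin d) → ℝ≥0∞} (hg : Measurable g)
    (K : Finset (Fin N)) :
    Measurable fun y : K → EuclideanSpace ℝ (Fin d) => ∏ l, g (y l) :=
  Finset.measurable_fun_prod _ fun l _ => hg.comp (measurable_messageAt K l)

lemma measurable_sharedMessage (K : Finset (Fin N)) :
    Measurable fun m : EuclideanSpace ℝ (Fin d) => (⟨K, fun _ => m⟩ : Transcript N d) :=
  (measurable_sigmaMk K).comp (measurable_pi_lambda _ fun _ => measurable_id)

lemma isProbabilityMeasure_stepShared (hγ₂ : γ₂ ∈ Set.Ioo (0 : ℝ) 1) (i : Fin N)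
    (μ : Measure (EuclideanSpace ℝ (Fin d))) [IsProbabilityMeasure μ] :
    IsProbabilityMeasure (stepShared γ₂ i μ) :=
  isProbabilityMeasure_uniformMixture (recipientSets_nonempty hγ₂ i) _ fun K _ =>
    Measure.isProbabilityMeasure_map (measurable_sharedMessage K).aemeasurable

variable {α : ℝ} {P Q : Measure (EuclideanSpace ℝ (Fin d))} [IsProbabilityMeasure P]
  [IsProbabilityMeasure Q] {B : ℝ≥0∞}

/-- The law of the recipient set is the same for both data sets and is part of the output, so the
density at a transcript is just the product of the message densities. Each set contributes one
factor `B` per recipient. -/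
lemma RenyiBound.stepFresh (hγ₂ : γ₂ ∈ Set.Ioo (0 : ℝ) 1) (hα : 0 ≤ α) (i : Fin N)
    (h : RenyiBound α P Q B) :
    RenyiBound α (stepFresh γ₂ i P) (stepFresh γ₂ i Q) (B ^ ⌊γ₂ * (N : ℝ)⌋₊) := by
  obtain ⟨g, hg, rfl, hB⟩ := h
  have hG : Measurable fun z : Transcript N d => ∏ l, g (z.2 l) :=
    measurable_sigma (measurable_prod_messages hg)
  refine ⟨fun z => ∏ l, g (z.2 l), hG, ?_, ?_⟩
  · rw [DPMAC.stepFresh, DPMAC.stepFresh, ← uniformMixture_withDensity]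
    refine uniformMixture_congr fun K _ => ?_
    rw [← map_withDensity_comp _ (measurable_sigmaMk K) hG, pi_withDensity _ fun _ => hg]
  · rw [DPMAC.stepFresh, lintegral_uniformMixture]
    refine le_trans ?_ (inv_card_mul_sum_const (recipientSets_nonempty hγ₂ i) _).le
    gcongr with K hK
    rw [lintegral_map (hG.pow_const α) (measurable_sigmaMk K)]
    simp_rw [← ENNReal.prod_rpow_of_nonneg hα]
    rw [lintegral_pi_prod _ fun _ => hg.pow_const α, Finset.prod_const, Finset.card_univ,
      Fintype.card_coe, (Finset.mem_powersetCard.1 hK).2]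
    exact pow_le_pow_left' hB _

-- All recipients hold the same vector, so the density can be read off from any one of them. The
-- actual cost is a single `B`, or `1` if nobody is addressed; `1 ≤ B` weakens this to the same
-- power as for independent messages.
open Classical in
lemma RenyiBound.stepShared (hγ₂ : γ₂ ∈ Set.Ioo (0 : ℝ) 1) (hB₁ : 1 ≤ B) (i : Fin N)
    (h : RenyiBound α P Q B) :
    RenyiBound α (stepShared γ₂ i P) (stepShared γ₂ i Q) (B ^ ⌊γ₂ * (N : ℝ)⌋₊) := by
  obtain ⟨g, hg, rfl, hB⟩ := h
  let G : Transcript N d → ℝ≥0∞ := fun z =>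
    if hz : z.1.Nonempty then g (z.2 ⟨hz.choose, hz.choose_spec⟩) else 1
  have hG : Measurable G := measurable_sigma fun K => by
    by_cases hK : K.Nonempty
    · simp only [G, hK, dite_true]
      exact hg.comp (measurable_messageAt K ⟨hK.choose, hK.choose_spec⟩)
    · simp only [G, hK, dite_false]
      exact measurable_const
  refine ⟨G, hG, ?_, ?_⟩
  · rw [DPMAC.stepShared, DPMAC.stepShared, ← uniformMixture_withDensity]
    refine uniformMixture_congr fun K _ => ?_
    rw [← map_withDensity_comp _ (measurable_sharedMessage K) hG]
    by_cases hK : K.Nonempty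
    · simp only [G, hK, dite_true]
    -- With no recipients the message is discarded: both laws are the point mass at the empty
    -- transcript.
    · simp only [G, hK, dite_false, withDensity_const, one_smul]
      obtain rfl : K = ∅ := Finset.not_nonempty_iff_eq_empty.1 hK
      have hconst : (fun m : EuclideanSpace ℝ (Fin d) => (⟨∅, fun _ => m⟩ : Transcript N d)) =
          fun _ => ⟨∅, fun _ => 0⟩ := by
        funext m
        congr 1
        funext l
        exact absurd l.2 (Finset.notMem_empty _)
      rw [hconst, Measure.map_const, Measure.map_const, measure_univ, measure_univ]
  · rw [DPMAC.stepShared, lintegral_uniformMixture]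
    refine le_trans ?_ (inv_card_mul_sum_const (recipientSets_nonempty hγ₂ i) _).le
    gcongr with K hK
    have hcard := (Finset.mem_powersetCard.1 hK).2
    rw [lintegral_map (hG.pow_const α) (measurable_sharedMessage K)]
    by_cases hK' : K.Nonempty
    · simp only [G, hK', dite_true]
      exact hB.trans (le_self_pow hB₁ (hcard ▸ hK'.card_pos.ne'))
    · simp only [G, hK', dite_false]
      simpa using one_le_pow₀ hB₁

end steps

/-! ### Densities of shifted Gaussian noise. -/

section Gaussian

variable {d : ℕ} {v : ℝ}

/-- The density of `N(a, v I)` with respect to `N(0, v I)`. -/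
noncomputable def shiftDensity (v : ℝ) (a y : EuclideanSpace ℝ (Fin d)) : ℝ :=
  Real.exp (inner ℝ a y / v - ‖a‖ ^ 2 / (2 * v))

/-- The centred Gaussian measure with covariance `v I`. -/
noncomputable abbrev noise (d : ℕ) (v : ℝ) : Measure (EuclideanSpace ℝ (Fin d)) :=
  multivariateGaussian (0 : EuclideanSpace ℝ (Fin d)) (v • (1 : Matrix (Fin d) (Fin d) ℝ))

lemma shiftDensity_pos (v : ℝ) (a y : EuclideanSpace ℝ (Fin d)) : 0 < shiftDensity v a y :=
  Real.exp_pos _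

lemma measurable_shiftDensity_right (v : ℝ) (a : EuclideanSpace ℝ (Fin d)) :
    Measurable (shiftDensity v a) := by
  unfold shiftDensity
  fun_prop

/-- Both sides have characteristic function `exp (-v ‖t‖² / 2)`. This reduces the shift formula to
one dimension. -/
lemma noise_eq_map_pi (hv : 0 < v) :
    noise d v = (Measure.pi fun _ : Fin d => gaussianReal 0 v.toNNReal).map (WithLp.toLp 2) := by
  apply Measure.ext_of_charFun
  ext t
  rw [charFun_multivariateGaussian (Matrix.PosSemidef.one.smul hv.le), charFun_pi]
  simp_rw [charFun_gaussianReal]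
  rw [← Complex.exp_sum]
  congr 1
  simp only [inner_zero_right, Complex.ofReal_zero, mul_zero, zero_mul, zero_sub,
    Finset.sum_neg_distrib, Matrix.smul_mulVec, Matrix.one_mulVec, Pi.smul_apply, smul_eq_mul,
    Real.coe_toNNReal _ hv.le, dotProduct]
  push_cast
  rw [Finset.sum_div]
  congr 1
  refine Finset.sum_congr rfl fun i _ => ?_
  ring

lemma gaussianReal_eq_withDensity (hv : 0 < v) (a : ℝ) :
    gaussianReal a v.toNNReal = (gaussianReal 0 v.toNNReal).withDensity fun x =>
      ENNReal.ofReal (Real.exp (a * x / v - a ^ 2 / (2 * v))) := by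
  have hv' : v.toNNReal ≠ 0 := by simpa using hv
  rw [gaussianReal_of_var_ne_zero _ hv', gaussianReal_of_var_ne_zero _ hv',
    ← withDensity_mul _ (measurable_gaussianPDF _ _) (by fun_prop)]
  congr 1
  funext x
  rw [Pi.mul_apply, gaussianPDF, gaussianPDF, ← ENNReal.ofReal_mul (gaussianPDFReal_nonneg _ _ _),
    gaussianPDFReal, gaussianPDFReal, mul_assoc _ (Real.exp _), ← Real.exp_add, Real.coe_toNNReal _ hv.le]
  congr 3
  field_simp
  ring

lemma noise_map_const_add (hv : 0 < v) (a : EuclideanSpace ℝ (Fin d)) :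
    (noise d v).map (fun y => a + y) =
      (noise d v).withDensity fun y => ENNReal.ofReal (shiftDensity v a y) := by
  have hmeas : Measurable fun y : EuclideanSpace ℝ (Fin d) =>
      ENNReal.ofReal (shiftDensity v a y) :=
    (measurable_shiftDensity_right v a).ennreal_ofReal
  have hdens : ∀ l : Fin d, Measurable fun x =>
    ENNReal.ofReal (Real.exp (a l * x / v - a l ^ 2 / (2 * v))) := fun l => by fun_prop
  have : ∀ l : Fin d, IsProbabilityMeasure ((gaussianReal 0 v.toNNReal).withDensity fun x =>
      ENNReal.ofReal (Real.exp (a l * x / v - a l ^ 2 / (2 * v)))) := fun l => by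
    rw [← gaussianReal_eq_withDensity hv]; infer_instance
  rw [noise_eq_map_pi hv, ← map_withDensity_comp _ (by fun_prop) hmeas,
    Measure.map_map (by fun_prop) (by fun_prop)]
  have hcomp : (fun y => a + y) ∘ WithLp.toLp 2 =
      WithLp.toLp 2 ∘ fun (x : Fin d → ℝ) l => a l + x l := by
    funext x; ext l; simp
  rw [hcomp, ← Measure.map_map (by fun_prop) (by fun_prop),
    Measure.pi_map_pi (fun l => by fun_prop)]
  congr 1
  simp_rw [gaussianReal_map_const_add, zero_add]
  rw [show (fun l : Fin d => gaussianReal (a l) v.toNNReal) = fun l => _ from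
    funext fun l => gaussianReal_eq_withDensity hv (a l), pi_withDensity _ hdens]
  congr 1
  funext x
  rw [← ENNReal.ofReal_prod_of_nonneg fun _ _ => (Real.exp_pos _).le, ← Real.exp_sum, shiftDensity,
    Finset.sum_sub_distrib, ← Finset.sum_div, ← Finset.sum_div, EuclideanSpace.real_norm_sq_eq,
    PiLp.inner_apply]
  simp [mul_comm]

/-- The exponential moments of centred Gaussian noise. -/
lemma integrable_exp_inner_noise (hv : 0 < v) (a : EuclideanSpace ℝ (Fin d)) (c : ℝ) :
    Integrable (fun y => Real.exp (inner ℝ a y / v + c)) (noise d v) ∧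
      ∫ y, Real.exp (inner ℝ a y / v + c) ∂noise d v = Real.exp (‖a‖ ^ 2 / (2 * v) + c) := by
  have hmeas := measurable_shiftDensity_right v a
  -- The shifted noise has mass one; this yields the exponential moment without computing an
  -- integral.
  have hl : ∫⁻ y, ENNReal.ofReal (shiftDensity v a y) ∂noise d v = 1 := by
    rw [← setLIntegral_univ, ← withDensity_apply _ MeasurableSet.univ, ← noise_map_const_add hv,
      Measure.map_apply (by fun_prop) MeasurableSet.univ, Set.preimage_univ, measure_univ]
  have hnn : 0 ≤ᵐ[noise d v] fun y => shiftDensity v a y :=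
    Filter.Eventually.of_forall fun y => (shiftDensity_pos v a y).le
  have hintegrable : Integrable (fun y => shiftDensity v a y) (noise d v) :=
    (lintegral_ofReal_ne_top_iff_integrable hmeas.aestronglyMeasurable hnn).1 (by simp [hl])
  have hone : ∫ y, shiftDensity v a y ∂noise d v = 1 := by
    rw [integral_eq_lintegral_of_nonneg_ae hnn hmeas.aestronglyMeasurable, hl]; simp
  have heq : (fun y => Real.exp (inner ℝ a y / v + c)) =
      fun y => Real.exp (‖a‖ ^ 2 / (2 * v) + c) * shiftDensity v a y := by
    funext y
    rw [shiftDensity, ← Real.exp_add]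
    congr 1
    ring
  rw [heq]
  exact ⟨hintegrable.const_mul _, by rw [integral_const_mul, hone, mul_one]⟩

end Gaussian

/-! ### Elementary inequalities: Taylor bounds for powers and numerical estimates. -/

section RealInequalities

/-- The convex function `s ↦ s^p` lies above its tangent at `1 + t`, evaluated at `s = 1`; this is
Bernoulli's inequality after scaling. -/
lemma rpow_one_add_le_tangent {t p : ℝ} (ht : 0 ≤ t) (hp : 1 ≤ p) :
    (1 + t) ^ p ≤ 1 + p * t * (1 + t) ^ (p - 1) := by
  have h1 : 0 < 1 + t := by linarith
  have hs : -1 ≤ -t / (1 + t) := by rw [le_div_iff₀ h1]; linarith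
  have h := one_add_mul_self_le_rpow_one_add hs hp
  have heq : 1 + -t / (1 + t) = (1 + t)⁻¹ := by field_simp; ring
  rw [heq, Real.inv_rpow h1.le] at h
  have hpos : 0 < (1 + t) ^ p := Real.rpow_pos_of_pos h1 p
  have h2 := mul_le_mul_of_nonneg_left h hpos.le
  rw [mul_inv_cancel₀ hpos.ne'] at h2
  have h3 : (1 + t) ^ p = (1 + t) ^ (p - 1) * (1 + t) := by
    rw [← Real.rpow_add_one h1.ne', sub_add_cancel]
  have h4 : (1 + t) ^ p * (1 + p * (-t / (1 + t))) =
      (1 + t) ^ p - p * t * (1 + t) ^ (p - 1) := by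
    rw [h3]; field_simp; ring
  linarith

/-- A second order Taylor bound for real powers. -/
lemma rpow_one_add_le_of_nonneg {z α : ℝ} (hz : 0 ≤ z) (hα : 2 ≤ α) :
    (1 + z) ^ α ≤ 1 + α * z + α * (α - 1) / 2 * (z ^ 2 * (1 + z) ^ (α - 2)) := by
  -- Freezing this factor at the endpoint `z` leaves a function of `t` whose derivative is
  -- nonnegative on `[0, z]` by the tangent inequality with exponent `α - 1`.
  set u := (1 + z) ^ (α - 2) with hu
  let F : ℝ → ℝ := fun t => 1 + α * t + α * (α - 1) / 2 * (t ^ 2 * u) - (1 + t) ^ α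
  have hd : ∀ t, 0 ≤ t → HasDerivAt F
      (α + α * (α - 1) * (t * u) - α * (1 + t) ^ (α - 1)) t := by
    intro t ht
    have h1 : HasDerivAt (fun t : ℝ => (1 + t) ^ α) (1 * α * (1 + t) ^ (α - 1)) t :=
      ((hasDerivAt_id t).const_add 1).rpow_const (Or.inl (by simp; linarith))
    have h2 : HasDerivAt (fun t : ℝ => 1 + α * t + α * (α - 1) / 2 * (t ^ 2 * u))
        (α * 1 + α * (α - 1) / 2 * ((2 * t) * u)) t := by
      refine (((hasDerivAt_id t).const_mul α).const_add 1).add ?_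
      refine (HasDerivAt.mul_const ?_ u).const_mul _
      simpa using hasDerivAt_pow 2 t
    convert! h2.sub h1 using 1
    ring
  have hmono : MonotoneOn F (Set.Icc 0 z) := by
    refine monotoneOn_of_deriv_nonneg (convex_Icc 0 z)
      (fun t ht => (hd t ht.1).continuousAt.continuousWithinAt) ?_ ?_
    · intro t ht
      rw [interior_Icc] at ht
      exact (hd t ht.1.le).differentiableAt.differentiableWithinAt
    · intro t ht
      rw [interior_Icc] at ht
      rw [(hd t ht.1.le).deriv]
      have h1 := rpow_one_add_le_tangent ht.1.le (p := α - 1) (by linarith)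
      have h2 : (1 + t) ^ (α - 1 - 1) ≤ u := by
        rw [hu, show α - 1 - 1 = α - 2 by ring]
        exact Real.rpow_le_rpow (by linarith [ht.1]) (by linarith [ht.2]) (by linarith)
      have h3 : (α - 1) * t * (1 + t) ^ (α - 1 - 1) ≤ (α - 1) * t * u :=
        mul_le_mul_of_nonneg_left h2 (mul_nonneg (by linarith) ht.1.le)
      nlinarith
  have := hmono ⟨le_rfl, hz⟩ ⟨hz, le_rfl⟩ hz
  simp only [F] at this
  norm_num at this
  linarith

lemma rpow_one_sub_le {t α : ℝ} (ht : 0 ≤ t) (ht1 : t ≤ 1) (hα : 2 ≤ α) :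
    (1 - t) ^ α ≤ 1 - α * t + α * (α - 1) / 2 * t ^ 2 := by
  let F : ℝ → ℝ := fun t => 1 - α * t + α * (α - 1) / 2 * t ^ 2 - (1 - t) ^ α
  have hd : ∀ t, HasDerivAt F
      (-α + α * (α - 1) * t + α * (1 - t) ^ (α - 1)) t := by
    intro t
    have h1 : HasDerivAt (fun t : ℝ => (1 - t) ^ α) (-1 * α * (1 - t) ^ (α - 1)) t :=
      ((hasDerivAt_id t).const_sub 1).rpow_const (Or.inr (by linarith))
    have h2 : HasDerivAt (fun t : ℝ => 1 - α * t + α * (α - 1) / 2 * t ^ 2)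
        (-(α * 1) + α * (α - 1) / 2 * (2 * t)) t := by
      refine (((hasDerivAt_id t).const_mul α).const_sub 1).add ?_
      refine HasDerivAt.const_mul _ ?_
      simpa using hasDerivAt_pow 2 t
    convert! h2.sub h1 using 1
    ring
  have hmono : MonotoneOn F (Set.Icc 0 t) := by
    refine monotoneOn_of_deriv_nonneg (convex_Icc 0 t)
      (fun t _ => (hd t).continuousAt.continuousWithinAt)
      (fun t _ => (hd t).differentiableAt.differentiableWithinAt) ?_
    intro r hr
    rw [interior_Icc] at hr
    rw [(hd r).deriv]
    have h1 := one_add_mul_self_le_rpow_one_add (s := -r) (by linarith [hr.2]) (p := α - 1)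
      (by linarith)
    rw [← sub_eq_add_neg] at h1
    nlinarith
  have := hmono ⟨le_rfl, ht⟩ ⟨ht, le_rfl⟩ ht
  simp only [F] at this
  norm_num at this
  linarith

lemma rpow_one_add_le {z α : ℝ} (hz : -1 ≤ z) (hα : 2 ≤ α) :
    (1 + z) ^ α ≤ 1 + α * z + α * (α - 1) / 2 * (z ^ 2 * (1 + |z|) ^ (α - 2)) := by
  rcases le_total 0 z with h | h
  · rw [abs_of_nonneg h]
    exact rpow_one_add_le_of_nonneg h hα
  · have h1 := rpow_one_sub_le (t := -z) (by linarith) (by linarith) hα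
    have h2 : (1 : ℝ) ≤ (1 + |z|) ^ (α - 2) :=
      Real.one_le_rpow (by linarith [abs_nonneg z]) (by linarith)
    have h3 : z ^ 2 * 1 ≤ z ^ 2 * (1 + |z|) ^ (α - 2) := by gcongr
    have h4 : 0 ≤ α * (α - 1) / 2 := by nlinarith
    have h5 := mul_le_mul_of_nonneg_left h3 h4
    rw [sub_neg_eq_add] at h1
    nlinarith

/-- Since `a / n ≤ 1`, Bernoulli gives `(1 + y)^(a/n) ≤ 1 + (a/n) y`; raise this to the power `n`.
Real powers are thereby traded for integer ones, whose Gaussian moments are explicit. -/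
lemma rpow_one_add_le_sum {y a : ℝ} (hy : 0 ≤ y) (ha : 0 ≤ a) {n : ℕ} (hn : 0 < n)
    (han : a ≤ n) :
    (1 + y) ^ a ≤ ∑ j ∈ Finset.range (n + 1), (n.choose j : ℝ) * (a / n) ^ j * y ^ j := by
  have hn' : (0 : ℝ) < n := by exact_mod_cast hn
  have h1 : (1 + y) ^ (a / n) ≤ 1 + a / n * y :=
    rpow_one_add_le_one_add_mul_self (by linarith) (by positivity) (by rwa [div_le_one hn'])
  have h2 : (1 + y) ^ a = ((1 + y) ^ (a / n)) ^ n := by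
    rw [← Real.rpow_natCast, ← Real.rpow_mul (by linarith)]
    congr 1
    field_simp
  rw [h2]
  refine (pow_le_pow_left₀ (by positivity) h1 n).trans (le_of_eq ?_)
  rw [add_comm, add_pow]
  refine Finset.sum_congr rfl fun j _ => ?_
  rw [one_pow, mul_one, mul_pow]
  ring

/-- Convexity of `s ↦ s^(-k)`. It replaces the mixture in a denominator by its single components. -/
lemma inv_pow_convexCombination_le {p q γ : ℝ} (hp : 0 < p) (hq : 0 < q) (hγ : 0 ≤ γ)
    (hγ1 : γ ≤ 1) (k : ℕ) :
    (((1 - γ) * p + γ * q) ^ k)⁻¹ ≤ (1 - γ) * (p ^ k)⁻¹ + γ * (q ^ k)⁻¹ := by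
  have h := (convexOn_zpow (𝕜 := ℝ) (-(k : ℤ))).2 (Set.mem_Ioi.2 hp) (Set.mem_Ioi.2 hq)
    (sub_nonneg.2 hγ1) hγ (by ring)
  simpa [zpow_neg, zpow_natCast] using h

lemma abs_sub_pow_le {p q : ℝ} (hp : 0 ≤ p) (hq : 0 ≤ q) (k : ℕ) :
    |p - q| ^ k ≤ p ^ k + q ^ k := by
  rcases le_total p q with h | h
  · rw [abs_of_nonpos (by linarith)]
    exact (pow_le_pow_left₀ (by linarith) (by linarith : -(p - q) ≤ q) k).trans
      (le_add_of_nonneg_left (by positivity))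
  · rw [abs_of_nonneg (by linarith)]
    exact (pow_le_pow_left₀ (by linarith) (by linarith : p - q ≤ p) k).trans
      (le_add_of_nonneg_right (by positivity))

/-- The expansion of `Y (X / Y) ^ α` around `X = Y` for `α ≥ 2`. -/
lemma mul_div_rpow_le_sum {X Y α : ℝ} (hX : 0 < X) (hY : 0 < Y) (hα : 2 ≤ α) {n : ℕ} (hn : 0 < n)
    (hαn : α - 2 ≤ n) :
    Y * (X / Y) ^ α ≤ Y + α * (X - Y) + ∑ j ∈ Finset.range (n + 1),
      α * (α - 1) / 2 * ((n.choose j : ℝ) * ((α - 2) / n) ^ j) *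
        (|X - Y| ^ (j + 2) / Y ^ (j + 1)) := by
  have hz : X / Y = 1 + (X - Y) / Y := by field_simp; ring
  have hz1 : -1 ≤ (X - Y) / Y := by
    have : 0 < X / Y := by positivity
    linarith
  have h1 := rpow_one_add_le hz1 hα
  rw [← hz] at h1
  have h2 := rpow_one_add_le_sum (abs_nonneg ((X - Y) / Y)) (sub_nonneg.2 hα) hn hαn
  have hc : 0 ≤ α * (α - 1) / 2 := by nlinarith
  have h3 : (X / Y) ^ α ≤ 1 + α * ((X - Y) / Y) + α * (α - 1) / 2 * (((X - Y) / Y) ^ 2 *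
      ∑ j ∈ Finset.range (n + 1),
        (n.choose j : ℝ) * ((α - 2) / n) ^ j * |(X - Y) / Y| ^ j) := by
    refine h1.trans ?_
    gcongr
  refine (mul_le_mul_of_nonneg_left h3 hY.le).trans (le_of_eq ?_)
  rw [mul_add, Finset.mul_sum, Finset.mul_sum, Finset.mul_sum]
  congr 1
  · field_simp
  · refine Finset.sum_congr rfl fun j _ => ?_
    rw [← sq_abs, abs_div, abs_of_pos hY, pow_add |X - Y| j 2, div_pow |X - Y| Y 2,
      div_pow |X - Y| Y j]
    field_simp
    ring

/-- The expansion of `Y (X / Y) ^ α` around `X = Y` for `1 ≤ α ≤ 2`. -/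
lemma mul_div_rpow_le_of_le_two {X Y α : ℝ} (hX : 0 < X) (hY : 0 < Y) (hα : 1 ≤ α)
    (hα2 : α ≤ 2) :
    Y * (X / Y) ^ α ≤ Y + α * (X - Y) + (α - 1) * (|X - Y| ^ 2 / Y) := by
  have hz : X / Y = 1 + (X - Y) / Y := by field_simp; ring
  have hpos : 0 < X / Y := by positivity
  have hz1 : -1 ≤ (X - Y) / Y := by linarith
  have h1 := rpow_one_add_le_one_add_mul_self hz1 (p := α - 1) (by linarith) (by linarith)
  rw [← hz] at h1
  have h2 : (X / Y) ^ α = (X / Y) ^ (α - 1) * (X / Y) := by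
    rw [← Real.rpow_add_one hpos.ne', sub_add_cancel]
  rw [h2]
  calc Y * ((X / Y) ^ (α - 1) * (X / Y)) ≤ Y * ((1 + (α - 1) * ((X - Y) / Y)) * (X / Y)) := by
        gcongr
    _ = _ := by rw [sq_abs]; field_simp; ring

/-- The maximal `χ²`-type moment of three Gaussians with mutual squared distances at most `x`. -/
lemma exp_add_exp_sub_le {x P R w : ℝ} (hP : 0 ≤ P) (hR : 0 ≤ R) (hPx : P ≤ x) (hRx : R ≤ x)
    (hw : (P + R - x) / 2 ≤ w) :
    Real.exp P + Real.exp R - 2 * Real.exp w ≤ 2 * Real.exp x - 2 * Real.exp (x / 2) := by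
  have sq : ∀ u : ℝ, Real.exp u = Real.exp (u / 2) ^ 2 := fun u => by
    rw [← Real.exp_nat_mul]; congr 1; push_cast; ring
  set t := Real.exp (P / 2) with ht
  set r := Real.exp (R / 2) with hr
  set h := Real.exp (x / 2) with hh
  have ht1 : 1 ≤ t := Real.one_le_exp (by linarith)
  have hr1 : 1 ≤ r := Real.one_le_exp (by linarith)
  have hth : t ≤ h := Real.exp_le_exp.2 (by linarith)
  have hrh : r ≤ h := Real.exp_le_exp.2 (by linarith)
  have hh0 : 0 < h := Real.exp_pos _
  have hw' : t * r / h ≤ Real.exp w := by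
    rw [ht, hr, hh, ← Real.exp_add, ← Real.exp_sub]
    exact Real.exp_le_exp.2 (by linarith)
  rw [sq P, sq R, sq x]
  have hrh' : r / h ≤ 1 := (div_le_one hh0).2 hrh
  have e1 : t * r / h = t * (r / h) := by ring
  have e2 : r / h * h = r := div_mul_cancel₀ _ hh0.ne'
  -- The sum of the products in `k1` and `k2` is exactly `2h² - 2h - (t² + r² - 2tr/h)`.
  have k1 : 0 ≤ (h - t) * (h + t - 2 * (r / h)) :=
    mul_nonneg (by linarith) (by linarith)
  have k2 : 0 ≤ (h - r) * (h + r - 2) := mul_nonneg (by linarith) (by linarith)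
  nlinarith

/-- Factor out `exp (x/2) ≤ 2.1` and bound `exp (x/2) - 1` by the chord of `exp` over `[0, 5/7]`:
this gives `2 · 2.1 · 0.77 = 3.234 < 3.5`. The range `x ≤ 10/7` is the assumption `σ'² ≥ 0.7`. -/
lemma two_mul_exp_sub_le {x : ℝ} (hx : 0 ≤ x) (hx1 : x ≤ 10 / 7) :
    2 * Real.exp x - 2 * Real.exp (x / 2) ≤ 3.5 * x := by
  have he : Real.exp (5 / 7) ≤ 2.1 := by
    have h1 : Real.exp (5 / 7) ^ 7 = Real.exp 1 ^ 5 := by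
      rw [← Real.exp_nat_mul, ← Real.exp_nat_mul]; norm_num
    have h2 : Real.exp 1 ^ 5 ≤ 2.1 ^ 7 :=
      (pow_le_pow_left₀ (Real.exp_pos 1).le Real.exp_one_lt_d9.le 5).trans (by norm_num)
    by_contra h
    push Not at h
    have := pow_lt_pow_left₀ h (by norm_num) (n := 7) (by norm_num)
    linarith
  have hconv := convexOn_exp.2 (Set.mem_univ 0) (Set.mem_univ (5 / 7 : ℝ))
    (show 0 ≤ 1 - 7 / 10 * x by linarith) (show 0 ≤ 7 / 10 * x by linarith) (by ring)
  simp only [smul_eq_mul, mul_zero, zero_add, Real.exp_zero, mul_one] at hconv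
  rw [show 7 / 10 * x * (5 / 7) = x / 2 by ring] at hconv
  have h1 : Real.exp (x / 2) - 1 ≤ 0.77 * x := by nlinarith
  have h2 : Real.exp (x / 2) ≤ 2.1 := (Real.exp_le_exp.2 (by linarith)).trans he
  have h3 : Real.exp x = Real.exp (x / 2) * Real.exp (x / 2) := by
    rw [← Real.exp_add]; congr 1; ring
  have h0 : 1 ≤ Real.exp (x / 2) := Real.one_le_exp (by linarith)
  nlinarith [mul_le_mul h2 h1 (by linarith) (by norm_num)]

lemma exp_three_halves_le {x : ℝ} (hx : 0 ≤ x) (hx1 : x ≤ 10 / 7) :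
    Real.exp (1.5 * x) ≤ 5.25 * (1 + x) := by
  have he : Real.exp (15 / 7) ≤ 10 := by
    have h1 : Real.exp (15 / 7) ^ 7 = Real.exp 1 ^ 15 := by
      rw [← Real.exp_nat_mul, ← Real.exp_nat_mul]; norm_num
    have h2 : Real.exp 1 ^ 15 ≤ 10 ^ 7 :=
      (pow_le_pow_left₀ (Real.exp_pos 1).le Real.exp_one_lt_d9.le 15).trans (by norm_num)
    by_contra h
    push Not at h
    have := pow_lt_pow_left₀ h (by norm_num) (n := 7) (by norm_num)
    linarith
  have hconv := convexOn_exp.2 (Set.mem_univ 0) (Set.mem_univ (15 / 7 : ℝ))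
    (show 0 ≤ 1 - 7 / 10 * x by linarith) (show 0 ≤ 7 / 10 * x by linarith) (by ring)
  simp only [smul_eq_mul, mul_zero, zero_add, Real.exp_zero, mul_one] at hconv
  rw [show 7 / 10 * x * (15 / 7) = 1.5 * x by ring] at hconv
  nlinarith

/-- The bound on the moment of order `k + 2` of the difference of two Gaussian densities. -/
noncomputable def momentBound (x : ℝ) (k : ℕ) : ℝ :=
  if k = 0 then 3.5 * x else 2 * Real.exp ((k + 1) * (k + 2) * x / 2)

/-- The `j = 0` term is `3.5 x`. In the others, the smallness of `γ α` must beat the growth `exp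
((j+1)(j+2)x/2)` of the Gaussian moments, which leaves a total of at most another `3.5 x`. -/
lemma sum_momentBound_le {x γ α : ℝ} {n : ℕ} (hx : 0 < x) (hx1 : x ≤ 10 / 7) (hγ : 0 ≤ γ)
    (hα : 2 ≤ α) (hn : n = ⌊α - 2⌋₊ + 1)
    (hγα : γ * α * (1 + x) ≤ x * Real.exp (-(1.5 * (α - 1) * x))) :
    ∑ j ∈ Finset.range (n + 1), (n.choose j : ℝ) * ((α - 2) / n) ^ j * γ ^ j * momentBound x j ≤
      7 * x := by
  have hn0 : (0 : ℝ) < n := by rw [hn]; positivity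
  rw [Finset.sum_range_succ']
  have h0 : (n.choose 0 : ℝ) * ((α - 2) / n) ^ 0 * γ ^ 0 * momentBound x 0 = 3.5 * x := by
    simp [momentBound]
  rw [h0]
  suffices h : ∑ j ∈ Finset.range n, (n.choose (j + 1) : ℝ) * ((α - 2) / n) ^ (j + 1) *
      γ ^ (j + 1) * momentBound x (j + 1) ≤ 3.5 * x by linarith
  -- The absorption of exponentials used for `α ≥ 3` fails below that threshold, where only one term
  -- is present. It is treated by hand, using `3(α - 2) ≤ α`.
  rcases lt_or_ge (α - 2) 1 with ha | ha
  · obtain rfl : n = 1 := by rw [hn, Nat.floor_eq_zero.2 ha]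
    simp only [Finset.range_one, Finset.sum_singleton, zero_add, Nat.choose_self, Nat.cast_one,
      div_one, pow_one, one_mul, momentBound, one_ne_zero, if_false]
    have e1 : Real.exp ((1 + 1) * (1 + 2) * x / 2) = Real.exp (3 * x) := by congr 1; ring
    have e2 : Real.exp (-(1.5 * (α - 1) * x)) * Real.exp (3 * x) ≤ Real.exp (1.5 * x) := by
      rw [← Real.exp_add]
      exact Real.exp_le_exp.2 (by nlinarith)
    have e3 := exp_three_halves_le hx.le hx1
    rw [e1]
    have h1 : γ * α * (1 + x) * Real.exp (3 * x) ≤ x * (5.25 * (1 + x)) := by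
      calc _ ≤ x * Real.exp (-(1.5 * (α - 1) * x)) * Real.exp (3 * x) := by gcongr
        _ = x * (Real.exp (-(1.5 * (α - 1) * x)) * Real.exp (3 * x)) := by ring
        _ ≤ _ := mul_le_mul_of_nonneg_left (e2.trans e3) hx.le
    have h2 : γ * α * Real.exp (3 * x) ≤ 5.25 * x := by
      have : (γ * α * Real.exp (3 * x)) * (1 + x) ≤ (5.25 * x) * (1 + x) := by linarith
      exact le_of_mul_le_mul_right this (by linarith)
    have h3 : 3 * (α - 2) * (γ * Real.exp (3 * x)) ≤ α * (γ * Real.exp (3 * x)) :=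
      mul_le_mul_of_nonneg_right (by linarith) (by positivity)
    nlinarith
  · have hterm : ∀ j ∈ Finset.range n, (n.choose (j + 1) : ℝ) * ((α - 2) / n) ^ (j + 1) *
        γ ^ (j + 1) * momentBound x (j + 1) ≤ 2 * x * (1 / ((j + 1).factorial : ℝ)) := by
      intro j hj
      have hjn : (j : ℝ) + 1 ≤ n := by exact_mod_cast Finset.mem_range.1 hj
      have hnα : (n : ℝ) ≤ α - 1 := by
        have := Nat.floor_le (show 0 ≤ α - 2 by linarith)
        rw [hn]; push_cast; linarith
      have hch : (n.choose (j + 1) : ℝ) ≤ (n : ℝ) ^ (j + 1) / ((j + 1).factorial : ℝ) :=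
        Nat.choose_le_pow_div (j + 1) n
      have hg : (α - 2) * γ ≤ x / (1 + x) * Real.exp (-(1.5 * (α - 1) * x)) := by
        rw [div_mul_eq_mul_div, le_div_iff₀ (by linarith)]
        refine le_trans ?_ hγα
        nlinarith [mul_nonneg hγ (by linarith : 0 ≤ 1 + x)]
      have hx2 : (x / (1 + x)) ^ (j + 1) ≤ x := by
        have h1 : x / (1 + x) ≤ 1 := by rw [div_le_one (by linarith)]; linarith
        calc (x / (1 + x)) ^ (j + 1) ≤ (x / (1 + x)) ^ 1 :=
              pow_le_pow_of_le_one (by positivity) h1 (by omega)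
          _ ≤ x := by rw [pow_one, div_le_iff₀ (by linarith)]; nlinarith
      have hexp : Real.exp (-(1.5 * (α - 1) * x)) ^ (j + 1) *
          Real.exp (((j : ℝ) + 1 + 1) * ((j : ℝ) + 1 + 2) * x / 2) ≤ 1 := by
        rw [← Real.exp_nat_mul, ← Real.exp_add, Real.exp_le_one_iff]
        push_cast
        -- For `j = 0` this is `α ≥ 3`; for `j ≥ 1` it follows from `j + 1 ≤ n ≤ α - 1`. It is what
        -- dictates the factor `1.5` in the hypothesis on `α`.
        have hE : ((j : ℝ) + 2) * (j + 3) / 2 ≤ 1.5 * (j + 1) * (α - 1) := by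
          rcases Nat.eq_zero_or_pos j with rfl | hj0
          · norm_num; linarith
          · have hj1 : (1 : ℝ) ≤ j := by exact_mod_cast hj0
            nlinarith
        nlinarith
      have hpow : ((α - 2) * γ) ^ (j + 1) ≤
          x * Real.exp (-(1.5 * (α - 1) * x)) ^ (j + 1) := by
        refine (pow_le_pow_left₀ (mul_nonneg (by linarith) hγ) hg _).trans ?_
        rw [mul_pow]
        gcongr
      rw [momentBound, if_neg (Nat.succ_ne_zero j)]
      push_cast
      set E := Real.exp (((j : ℝ) + 1 + 1) * ((j : ℝ) + 1 + 2) * x / 2)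
      have ha0 : 0 ≤ (α - 2) / n := by apply div_nonneg <;> linarith
      calc (n.choose (j + 1) : ℝ) * ((α - 2) / n) ^ (j + 1) * γ ^ (j + 1) * (2 * E)
          ≤ (n : ℝ) ^ (j + 1) / ((j + 1).factorial : ℝ) * ((α - 2) / n) ^ (j + 1) *
              γ ^ (j + 1) * (2 * E) := by gcongr
        _ = 2 / ((j + 1).factorial : ℝ) * (((α - 2) * γ) ^ (j + 1) * E) := by
            rw [div_pow, mul_pow]; field_simp
        _ ≤ 2 / ((j + 1).factorial : ℝ) *
              (x * Real.exp (-(1.5 * (α - 1) * x)) ^ (j + 1) * E) := by gcongr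
        _ = 2 / ((j + 1).factorial : ℝ) *
              (x * (Real.exp (-(1.5 * (α - 1) * x)) ^ (j + 1) * E)) := by ring
        _ ≤ 2 / ((j + 1).factorial : ℝ) * (x * 1) := by gcongr
        _ = _ := by ring
    refine (Finset.sum_le_sum hterm).trans ?_
    rw [← Finset.mul_sum]
    -- The inverse factorials from index one on sum to at most `e - 1`, and `2(e - 1) < 3.5`.
    have hs := Real.sum_le_exp_of_nonneg (zero_le_one' ℝ) (n + 1)
    rw [Finset.sum_range_succ'] at hs
    simp only [one_pow, Nat.factorial_zero, Nat.cast_one, div_one] at hs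
    have he := Real.exp_one_lt_d9
    nlinarith

end RealInequalities

/-! ### Moments of differences of Gaussian densities, and of one pair of mixtures. -/

section GaussianMoments

variable {d : ℕ} {v x : ℝ}

/-- The integrand is the exponential of an affine function with direction `(k+1) b - k p`, so the
exponential moment formula applies. -/
lemma integral_pow_div_pow_shiftDensity (hv : 0 < v) (b p : EuclideanSpace ℝ (Fin d)) (k : ℕ) :
    Integrable (fun y => shiftDensity v b y ^ (k + 1) / shiftDensity v p y ^ k) (noise d v) ∧
      ∫ y, shiftDensity v b y ^ (k + 1) / shiftDensity v p y ^ k ∂noise d v =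
        Real.exp (k * (k + 1) * (‖b - p‖ ^ 2 / v) / 2) := by
  have h := integrable_exp_inner_noise hv (((k : ℝ) + 1) • b - (k : ℝ) • p)
    (-(((k : ℝ) + 1) * ‖b‖ ^ 2 - k * ‖p‖ ^ 2) / (2 * v))
  have heq : (fun y => shiftDensity v b y ^ (k + 1) / shiftDensity v p y ^ k) = fun y =>
      Real.exp (inner ℝ (((k : ℝ) + 1) • b - (k : ℝ) • p) y / v +
        -(((k : ℝ) + 1) * ‖b‖ ^ 2 - k * ‖p‖ ^ 2) / (2 * v)) := by
    funext y
    rw [shiftDensity, shiftDensity, ← Real.exp_nat_mul, ← Real.exp_nat_mul, ← Real.exp_sub,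
      inner_sub_left, real_inner_smul_left, real_inner_smul_left]
    congr 1
    push_cast
    ring
  rw [heq]
  refine ⟨h.1, h.2.trans ?_⟩
  congr 1
  rw [norm_sub_sq_real, norm_sub_sq_real, norm_smul, norm_smul, real_inner_smul_left,
    real_inner_smul_right, mul_pow, mul_pow, Real.norm_eq_abs, Real.norm_eq_abs, sq_abs, sq_abs]
  field_simp
  ring

lemma integral_mul_div_shiftDensity (hv : 0 < v) (b c p : EuclideanSpace ℝ (Fin d)) :
    Integrable (fun y => shiftDensity v b y * shiftDensity v c y / shiftDensity v p y)
      (noise d v) ∧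
      ∫ y, shiftDensity v b y * shiftDensity v c y / shiftDensity v p y ∂noise d v =
        Real.exp ((‖b - p‖ ^ 2 / v + ‖c - p‖ ^ 2 / v - ‖b - c‖ ^ 2 / v) / 2) := by
  have h := integrable_exp_inner_noise hv (b + c - p)
    (-(‖b‖ ^ 2 + ‖c‖ ^ 2 - ‖p‖ ^ 2) / (2 * v))
  have heq : (fun y => shiftDensity v b y * shiftDensity v c y / shiftDensity v p y) = fun y =>
      Real.exp (inner ℝ (b + c - p) y / v + -(‖b‖ ^ 2 + ‖c‖ ^ 2 - ‖p‖ ^ 2) / (2 * v)) := by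
    funext y
    rw [shiftDensity, shiftDensity, shiftDensity, ← Real.exp_add, ← Real.exp_sub,
      inner_sub_left, inner_add_left]
    congr 1
    ring
  rw [heq]
  refine ⟨h.1, h.2.trans ?_⟩
  congr 1
  rw [norm_sub_sq_real, norm_sub_sq_real, norm_sub_sq_real, norm_sub_sq_real, norm_add_sq_real,
    inner_add_left]
  field_simp
  ring

lemma integrable_abs_sub_pow_div (hv : 0 < v) (b c p : EuclideanSpace ℝ (Fin d)) (k : ℕ) :
    Integrable (fun y => |shiftDensity v b y - shiftDensity v c y| ^ (k + 2) /
      shiftDensity v p y ^ (k + 1)) (noise d v) := by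
  refine ((integral_pow_div_pow_shiftDensity hv b p (k + 1)).1.add
    (integral_pow_div_pow_shiftDensity hv c p (k + 1)).1).mono' ?_ ?_
  · have hb := measurable_shiftDensity_right v b
    have hc := measurable_shiftDensity_right v c
    have hp := measurable_shiftDensity_right v p
    have habs : Measurable fun y => |shiftDensity v b y - shiftDensity v c y| :=
      (hb.sub hc).norm
    exact ((habs.pow_const _).div (hp.pow_const _)).aestronglyMeasurable
  · refine Filter.Eventually.of_forall fun y => ?_
    have hp := shiftDensity_pos v p y
    rw [Real.norm_of_nonneg (by positivity), Pi.add_apply, ← add_div]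
    gcongr
    exact abs_sub_pow_le (shiftDensity_pos v b y).le (shiftDensity_pos v c y).le _

/-- For `k = 0` the square is expanded exactly: only the cross term makes the result of order `x`.
For `k ≥ 1` the crude bound `|B - C|^m ≤ B^m + C^m` is enough. -/
lemma integral_abs_sub_pow_div_le (hv : 0 < v) {b c p : EuclideanSpace ℝ (Fin d)}
    (hx : 0 ≤ x) (hx1 : x ≤ 10 / 7) (hb : ‖b - p‖ ^ 2 / v ≤ x) (hc : ‖c - p‖ ^ 2 / v ≤ x)
    (hbc : ‖b - c‖ ^ 2 / v ≤ x) (k : ℕ) :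
    ∫ y, |shiftDensity v b y - shiftDensity v c y| ^ (k + 2) /
      shiftDensity v p y ^ (k + 1) ∂noise d v ≤ momentBound x k := by
  obtain ⟨ib, eb⟩ := integral_pow_div_pow_shiftDensity hv b p (k + 1)
  obtain ⟨ic, ec⟩ := integral_pow_div_pow_shiftDensity hv c p (k + 1)
  rcases Nat.eq_zero_or_pos k with rfl | hk
  · obtain ⟨im, em⟩ := integral_mul_div_shiftDensity hv b c p
    have heq : (fun y => |shiftDensity v b y - shiftDensity v c y| ^ (0 + 2) /
        shiftDensity v p y ^ (0 + 1)) = fun y =>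
        shiftDensity v b y ^ (0 + 1 + 1) / shiftDensity v p y ^ (0 + 1) +
          shiftDensity v c y ^ (0 + 1 + 1) / shiftDensity v p y ^ (0 + 1) -
          2 * (shiftDensity v b y * shiftDensity v c y / shiftDensity v p y) := by
      funext y
      rw [zero_add, zero_add, sq_abs]
      ring
    rw [heq, integral_sub (by exact ib.add ic) (im.const_mul 2), integral_add ib ic, integral_const_mul,
      eb, ec, em, momentBound, if_pos rfl]
    have e1 : ∀ u : ℝ, ((0 + 1 : ℕ) : ℝ) * (((0 + 1 : ℕ) : ℝ) + 1) * u / 2 = u := fun u => by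
      push_cast; ring
    rw [e1, e1]
    exact (exp_add_exp_sub_le (by positivity) (by positivity) hb hc (by linarith)).trans
      (two_mul_exp_sub_le hx hx1)
  · rw [momentBound, if_neg hk.ne']
    have hle : ∀ u : ℝ, u ≤ x → Real.exp (((k + 1 : ℕ) : ℝ) * (((k + 1 : ℕ) : ℝ) + 1) * u / 2) ≤
        Real.exp ((k + 1) * (k + 2) * x / 2) := fun u hu => by
      refine Real.exp_le_exp.2 ?_
      push_cast
      rw [show (k : ℝ) + 1 + 1 = k + 2 by ring]
      gcongr
    calc _ ≤ ∫ y, (shiftDensity v b y ^ (k + 1 + 1) / shiftDensity v p y ^ (k + 1) +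
          shiftDensity v c y ^ (k + 1 + 1) / shiftDensity v p y ^ (k + 1)) ∂noise d v := by
          refine integral_mono (integrable_abs_sub_pow_div hv b c p k) (ib.add ic) fun y => ?_
          have hp := shiftDensity_pos v p y
          simp only
          rw [← add_div]
          gcongr
          exact abs_sub_pow_le (shiftDensity_pos v b y).le (shiftDensity_pos v c y).le _
      _ ≤ _ := by
          rw [integral_add ib ic, eb, ec]
          linarith [hle _ hb, hle _ hc]

lemma integral_shiftDensity (hv : 0 < v) (a : EuclideanSpace ℝ (Fin d)) :
    Integrable (shiftDensity v a) (noise d v) ∧ ∫ y, shiftDensity v a y ∂noise d v = 1 := by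
  simpa using integral_pow_div_pow_shiftDensity hv a a 0

/-- The mixture density of a subsampled Gaussian mechanism. -/
noncomputable def mixDensity (v γ : ℝ) (a b y : EuclideanSpace ℝ (Fin d)) : ℝ :=
  (1 - γ) * shiftDensity v a y + γ * shiftDensity v b y

lemma mixDensity_pos {γ : ℝ} (hγ : 0 ≤ γ) (hγ1 : γ ≤ 1) (a b y : EuclideanSpace ℝ (Fin d)) :
    0 < mixDensity v γ a b y := by
  have ha := shiftDensity_pos v a y
  have hb := shiftDensity_pos v b y
  rcases hγ.eq_or_lt with rfl | h
  · simpa [mixDensity] using ha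
  · have := mul_nonneg (sub_nonneg.2 hγ1) ha.le
    have := mul_pos h hb
    unfold mixDensity
    linarith

/-- If `Y (X / Y) ^ α` is dominated by a polynomial in `|X - Y| / Y` then the Rényi moment of two
Gaussian mixtures is bounded through the moments of differences of Gaussian densities. -/
lemma lintegral_mixDensity_le (hv : 0 < v) {γ α : ℝ} (hγ : 0 ≤ γ) (hγ1 : γ ≤ 1)
    {a b c : EuclideanSpace ℝ (Fin d)} (hx : 0 ≤ x) (hx1 : x ≤ 10 / 7)
    (hab : ‖b - a‖ ^ 2 / v ≤ x) (hac : ‖c - a‖ ^ 2 / v ≤ x) (hbc : ‖b - c‖ ^ 2 / v ≤ x)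
    {n : ℕ} {κ : ℕ → ℝ} (hκ : ∀ j, 0 ≤ κ j)
    (h : ∀ X Y : ℝ, 0 < X → 0 < Y → Y * (X / Y) ^ α ≤ Y + α * (X - Y) +
      ∑ j ∈ Finset.range n, κ j * (|X - Y| ^ (j + 2) / Y ^ (j + 1))) :
    ∫⁻ y, ENNReal.ofReal (mixDensity v γ a c y *
      (mixDensity v γ a b y / mixDensity v γ a c y) ^ α) ∂noise d v ≤
      ENNReal.ofReal (1 + ∑ j ∈ Finset.range n, κ j * γ ^ (j + 2) * momentBound x j) := by
  obtain ⟨ia, ea⟩ := integral_shiftDensity hv a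
  obtain ⟨ib, eb⟩ := integral_shiftDensity hv b
  obtain ⟨ic, ec⟩ := integral_shiftDensity hv c
  let D : EuclideanSpace ℝ (Fin d) → ℕ → EuclideanSpace ℝ (Fin d) → ℝ := fun p j y =>
    |shiftDensity v b y - shiftDensity v c y| ^ (j + 2) / shiftDensity v p y ^ (j + 1)
  have iD : ∀ p j, Integrable (D p j) (noise d v) := fun p j =>
    integrable_abs_sub_pow_div hv b c p j
  let L : EuclideanSpace ℝ (Fin d) → ℝ := fun y =>
    (1 - γ) * shiftDensity v a y + γ * shiftDensity v c y +
      α * γ * (shiftDensity v b y - shiftDensity v c y)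
  have iL : Integrable L (noise d v) :=
    ((ia.const_mul _).add (ic.const_mul _)).add ((ib.sub ic).const_mul _)
  -- The first-order term vanishes because the densities centred at `b` and `c` have equal mass.
  have eL : ∫ y, L y ∂noise d v = 1 := by
    simp only [L]
    rw [integral_add (by exact (ia.const_mul _).add (ic.const_mul _))
      (by exact (ib.sub ic).const_mul _),
      integral_add (ia.const_mul _) (ic.const_mul _), integral_const_mul, integral_const_mul,
      integral_const_mul, integral_sub ib ic, ea, eb, ec]
    ring
  let G : EuclideanSpace ℝ (Fin d) → ℝ := fun y => L y + ∑ j ∈ Finset.range n,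
    κ j * γ ^ (j + 2) * ((1 - γ) * D a j y + γ * D c j y)
  have iS : ∀ j ∈ Finset.range n, Integrable (fun y =>
      κ j * γ ^ (j + 2) * ((1 - γ) * D a j y + γ * D c j y)) (noise d v) := fun j _ =>
    (((iD a j).const_mul _).add ((iD c j).const_mul _)).const_mul _
  have iG : Integrable G (noise d v) := iL.add (integrable_finsetSum _ iS)
  have hpt : ∀ y, mixDensity v γ a c y *
      (mixDensity v γ a b y / mixDensity v γ a c y) ^ α ≤ G y := by
    intro y
    have hX := mixDensity_pos (v := v) hγ hγ1 a b y
    have hY := mixDensity_pos (v := v) hγ hγ1 a c y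
    refine (h _ _ hX hY).trans ?_
    -- The common component at `a` cancels, so every power of the difference brings a factor `γ`.
    have hW : mixDensity v γ a b y - mixDensity v γ a c y =
        γ * (shiftDensity v b y - shiftDensity v c y) := by
      unfold mixDensity; ring
    rw [hW]
    simp only [G]
    refine add_le_add (le_of_eq ?_) (Finset.sum_le_sum fun j _ => ?_)
    · simp only [L, mixDensity]; ring
    · rw [abs_mul, abs_of_nonneg hγ, mul_pow, mul_assoc (κ j), mul_div_assoc]
      refine mul_le_mul_of_nonneg_left (mul_le_mul_of_nonneg_left ?_ (by positivity)) (hκ j)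
      have := mul_le_mul_of_nonneg_left (inv_pow_convexCombination_le (shiftDensity_pos v a y)
        (shiftDensity_pos v c y) hγ hγ1 (j + 1))
        (by positivity : 0 ≤ |shiftDensity v b y - shiftDensity v c y| ^ (j + 2))
      rw [div_eq_mul_inv]
      refine this.trans (le_of_eq ?_)
      simp only [D]
      ring
  calc _ ≤ ∫⁻ y, ENNReal.ofReal (G y) ∂noise d v :=
        lintegral_mono fun y => ENNReal.ofReal_le_ofReal (hpt y)
    _ = ENNReal.ofReal (∫ y, G y ∂noise d v) := by
        refine (ofReal_integral_eq_lintegral_ofReal iG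
          (Filter.Eventually.of_forall fun y => le_trans ?_ (hpt y))).symm
        have hX := mixDensity_pos (v := v) hγ hγ1 a b y
        have hY := mixDensity_pos (v := v) hγ hγ1 a c y
        positivity
    _ ≤ _ := by
        refine ENNReal.ofReal_le_ofReal ?_
        simp only [G]
        rw [integral_add iL (integrable_finsetSum _ iS), eL, integral_finsetSum _ iS]
        gcongr with j _
        rw [integral_const_mul, integral_add ((iD a j).const_mul _) ((iD c j).const_mul _),
          integral_const_mul, integral_const_mul]
        refine mul_le_mul_of_nonneg_left ?_ (mul_nonneg (hκ j) (by positivity))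
        have h1 := integral_abs_sub_pow_div_le hv hx hx1 hab hac hbc j
        have h2 := integral_abs_sub_pow_div_le hv hx hx1 hbc (p := c) (by simpa using hx) hbc j
        nlinarith

/-- The Rényi moment of order `α` of the subsampled Gaussian mechanism with sampling rate `γ`. -/
lemma lintegral_mixDensity_le_exp (hv : 0 < v) {γ α : ℝ} (hγ : 0 ≤ γ) (hγ1 : γ ≤ 1)
    (hα : 1 < α) {a b c : EuclideanSpace ℝ (Fin d)} (hx : 0 < x) (hx1 : x ≤ 10 / 7)
    (hab : ‖b - a‖ ^ 2 / v ≤ x) (hac : ‖c - a‖ ^ 2 / v ≤ x) (hbc : ‖b - c‖ ^ 2 / v ≤ x)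
    (hγα : γ * α * (1 + x) ≤ x * Real.exp (-(1.5 * (α - 1) * x))) :
    ∫⁻ y, ENNReal.ofReal (mixDensity v γ a c y *
      (mixDensity v γ a b y / mixDensity v γ a c y) ^ α) ∂noise d v ≤
      ENNReal.ofReal (Real.exp (3.5 * α * (α - 1) * γ ^ 2 * x)) := by
  -- For `α ≤ 2` the second moment alone suffices, with coefficient `α - 1 ≤ α (α - 1)`.
  rcases le_total α 2 with h2 | h2
  · refine (lintegral_mixDensity_le hv hγ hγ1 hx.le hx1 hab hac hbc (n := 1)
      (κ := fun _ => α - 1) (fun _ => by linarith) fun X Y hX hY => ?_).trans ?_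
    · simpa using mul_div_rpow_le_of_le_two hX hY hα.le h2
    · refine ENNReal.ofReal_le_ofReal (le_trans ?_ (Real.add_one_le_exp _))
      simp only [Finset.range_one, Finset.sum_singleton, momentBound, if_true, zero_add]
      have : 0 ≤ (α - 1) * ((α - 1) * γ ^ 2 * x) :=
        mul_nonneg (by linarith) (mul_nonneg (mul_nonneg (by linarith) (by positivity)) hx.le)
      nlinarith
  · set n := ⌊α - 2⌋₊ + 1 with hn
    have hcoef : 0 ≤ α * (α - 1) / 2 := by nlinarith
    refine (lintegral_mixDensity_le hv hγ hγ1 hx.le hx1 hab hac hbc (n := n + 1)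
      (κ := fun j => α * (α - 1) / 2 * ((n.choose j : ℝ) * ((α - 2) / n) ^ j))
      (fun j => ?_) fun X Y hX hY => ?_).trans ?_
    · have : 0 ≤ (α - 2) / n := div_nonneg (by linarith) (by positivity)
      positivity
    · refine mul_div_rpow_le_sum hX hY h2 (Nat.succ_pos _) ?_
      rw [hn]
      push_cast
      exact (Nat.lt_floor_add_one _).le
    · refine ENNReal.ofReal_le_ofReal (le_trans ?_ (Real.add_one_le_exp _))
      have hs := sum_momentBound_le hx hx1 hγ h2 hn hγα
      have heq : ∑ j ∈ Finset.range (n + 1), α * (α - 1) / 2 *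
          ((n.choose j : ℝ) * ((α - 2) / n) ^ j) * γ ^ (j + 2) * momentBound x j =
          α * (α - 1) / 2 * γ ^ 2 * ∑ j ∈ Finset.range (n + 1),
            (n.choose j : ℝ) * ((α - 2) / n) ^ j * γ ^ j * momentBound x j := by
        rw [Finset.mul_sum]
        refine Finset.sum_congr rfl fun j _ => ?_
        ring
      rw [heq]
      have := mul_le_mul_of_nonneg_left hs (mul_nonneg hcoef (sq_nonneg γ))
      linarith

end GaussianMoments

/-! ### Joint convexity and passage to mixtures. -/

section Convexity

/-- Joint convexity of `(x, y) ↦ y (x / y) ^ α`. -/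
lemma mul_div_rpow_lintegral_le {Θ : Type*} [MeasurableSpace Θ] (κ : Measure Θ) {α : ℝ}
    (hα : 1 < α) {x y : Θ → ℝ≥0∞} (hx : Measurable x) (hy : Measurable y) (hy0 : ∀ θ, y θ ≠ 0)
    (hyt : ∀ θ, y θ ≠ ∞) (hq0 : ∫⁻ θ, y θ ∂κ ≠ 0) (hqt : ∫⁻ θ, y θ ∂κ ≠ ∞) :
    (∫⁻ θ, y θ ∂κ) * ((∫⁻ θ, x θ ∂κ) / ∫⁻ θ, y θ ∂κ) ^ α ≤
      ∫⁻ θ, y θ * (x θ / y θ) ^ α ∂κ := by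
  set q := ∫⁻ θ, y θ ∂κ with hq
  have hα0 : 0 < α := by linarith
  have hconj : α.HolderConjugate (α / (α - 1)) := Real.HolderConjugate.conjExponent hα
  -- Hölder for the splitting `x = ((x/y) y^(1/α)) · y^(1 - 1/α)`.
  have hH := ENNReal.lintegral_mul_le_Lp_mul_Lq κ hconj
    (f := fun θ => x θ / y θ * y θ ^ (1 / α)) (g := fun θ => y θ ^ (1 - 1 / α))
    ((hx.div hy).mul (hy.pow_const _)).aemeasurable (hy.pow_const _).aemeasurable
  have e1 : ∀ θ, ((fun θ => x θ / y θ * y θ ^ (1 / α)) * fun θ => y θ ^ (1 - 1 / α)) θ =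
      x θ := fun θ => by
    simp only [Pi.mul_apply]
    rw [mul_assoc, ← ENNReal.rpow_add _ _ (hy0 θ) (hyt θ), add_sub_cancel, ENNReal.rpow_one,
      ENNReal.div_mul_cancel (hy0 θ) (hyt θ)]
  have e2 : ∀ θ, (x θ / y θ * y θ ^ (1 / α)) ^ α = y θ * (x θ / y θ) ^ α := fun θ => by
    rw [ENNReal.mul_rpow_of_nonneg _ _ hα0.le, ← ENNReal.rpow_mul, one_div_mul_cancel hα0.ne',
      ENNReal.rpow_one, mul_comm]
  have e3 : ∀ θ, (y θ ^ (1 - 1 / α)) ^ (α / (α - 1)) = y θ := fun θ => by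
    have : (1 - 1 / α) * (α / (α - 1)) = 1 := by
      have : α - 1 ≠ 0 := by linarith
      field_simp
    rw [← ENNReal.rpow_mul, this, ENNReal.rpow_one]
  simp only [e1, e2, e3] at hH
  rw [← hq] at hH
  have h2 := ENNReal.rpow_le_rpow hH hα0.le
  rw [ENNReal.mul_rpow_of_nonneg _ _ hα0.le, ← ENNReal.rpow_mul, ← ENNReal.rpow_mul,
    one_div_mul_cancel hα0.ne', ENNReal.rpow_one] at h2
  have e4 : 1 / (α / (α - 1)) * α = α - 1 := by field_simp
  rw [e4] at h2
  rw [ENNReal.div_rpow_of_nonneg _ _ hα0.le]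
  have hqα0 : q ^ α ≠ 0 := by simp [hq0, hqt]
  have hqαt : q ^ α ≠ ∞ := ENNReal.rpow_ne_top_of_nonneg hα0.le hqt
  rw [← mul_div_assoc, ENNReal.div_le_iff hqα0 hqαt]
  calc q * (∫⁻ θ, x θ ∂κ) ^ α ≤ q * ((∫⁻ θ, y θ * (x θ / y θ) ^ α ∂κ) * q ^ (α - 1)) := by gcongr
    _ = (∫⁻ θ, y θ * (x θ / y θ) ^ α ∂κ) * (q ^ (1 : ℝ) * q ^ (α - 1)) := by
        rw [ENNReal.rpow_one]; ring
    _ = _ := by rw [← ENNReal.rpow_add _ _ hq0 hqt, add_sub_cancel]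

/-- A uniform bound on the Rényi moments of the components of two mixtures over the same mixing
measure bounds the Rényi moment of the mixtures. -/
lemma renyiBound_withDensity_mixture {Θ E : Type*} [MeasurableSpace Θ] [MeasurableSpace E]
    (κ : Measure Θ) [IsProbabilityMeasure κ] (μ : Measure E) [SFinite μ] {α : ℝ} (hα : 1 < α)
    {X Y : Θ → E → ℝ} (mX : Measurable fun p : Θ × E => X p.1 p.2)
    (mY : Measurable fun p : Θ × E => Y p.1 p.2) (hX : ∀ θ y, 0 < X θ y) (hY : ∀ θ y, 0 < Y θ y)
    {M : E → ℝ} (hM : ∀ θ y, Y θ y ≤ M y) {B : ℝ≥0∞}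
    (hB : ∀ θ, ∫⁻ y, ENNReal.ofReal (Y θ y * (X θ y / Y θ y) ^ α) ∂μ ≤ B) :
    RenyiBound α (μ.withDensity fun y => ∫⁻ θ, ENNReal.ofReal (X θ y) ∂κ)
      (μ.withDensity fun y => ∫⁻ θ, ENNReal.ofReal (Y θ y) ∂κ) B := by
  set p : E → ℝ≥0∞ := fun y => ∫⁻ θ, ENNReal.ofReal (X θ y) ∂κ with hp
  set q : E → ℝ≥0∞ := fun y => ∫⁻ θ, ENNReal.ofReal (Y θ y) ∂κ with hq
  have mX' := mX.ennreal_ofReal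
  have mY' := mY.ennreal_ofReal
  have mp : Measurable p := mX'.lintegral_prod_left'
  have mq : Measurable q := mY'.lintegral_prod_left'
  have mXy : ∀ y, Measurable fun θ => ENNReal.ofReal (X θ y) := fun y =>
    mX'.comp measurable_prodMk_right
  have mYy : ∀ y, Measurable fun θ => ENNReal.ofReal (Y θ y) := fun y =>
    mY'.comp measurable_prodMk_right
  have hq0 : ∀ y, q y ≠ 0 := by
    intro y h
    simp only [hq] at h
    rw [lintegral_eq_zero_iff (mYy y)] at h
    obtain ⟨θ, hθ⟩ := h.exists
    simp only [Pi.zero_apply, ENNReal.ofReal_eq_zero] at hθ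
    exact absurd hθ (not_le.2 (hY θ y))
  -- The domination by `M`, uniform in `θ`, is what makes the mixed density finite, so that `p / q`
  -- is a genuine density.
  have hqt : ∀ y, q y ≠ ∞ := by
    intro y
    refine ne_top_of_le_ne_top (ENNReal.ofReal_ne_top (r := M y)) ?_
    calc q y ≤ ∫⁻ _θ, ENNReal.ofReal (M y) ∂κ :=
          lintegral_mono fun θ => ENNReal.ofReal_le_ofReal (hM θ y)
      _ = _ := by simp
  refine ⟨p / q, mp.div mq, ?_, ?_⟩
  · rw [← withDensity_mul _ mq (mp.div mq)]
    congr 1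
    funext y
    exact (ENNReal.mul_div_cancel (hq0 y) (hqt y)).symm
  · rw [lintegral_withDensity_eq_lintegral_mul _ mq ((mp.div mq).pow_const α)]
    have heq : ∀ θ y, ENNReal.ofReal (Y θ y) *
        (ENNReal.ofReal (X θ y) / ENNReal.ofReal (Y θ y)) ^ α =
        ENNReal.ofReal (Y θ y * (X θ y / Y θ y) ^ α) := fun θ y => by
      rw [← ENNReal.ofReal_div_of_pos (hY θ y),
        ENNReal.ofReal_rpow_of_pos (div_pos (hX θ y) (hY θ y)), ← ENNReal.ofReal_mul (hY θ y).le]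
    calc ∫⁻ y, (q * fun y => (p / q) y ^ α) y ∂μ
        ≤ ∫⁻ y, ∫⁻ θ, ENNReal.ofReal (Y θ y) *
            (ENNReal.ofReal (X θ y) / ENNReal.ofReal (Y θ y)) ^ α ∂κ ∂μ := by
          refine lintegral_mono fun y => ?_
          refine mul_div_rpow_lintegral_le κ hα (mXy y) (mYy y) (fun θ => ?_)
            (fun θ => ENNReal.ofReal_ne_top) (hq0 y) (hqt y)
          rw [Ne, ENNReal.ofReal_eq_zero, not_le]
          exact hY θ y
      _ = ∫⁻ θ, ∫⁻ y, ENNReal.ofReal (Y θ y) *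
            (ENNReal.ofReal (X θ y) / ENNReal.ofReal (Y θ y)) ^ α ∂μ ∂κ := by
          refine lintegral_lintegral_swap ?_
          exact ((mY'.mul ((mX'.div mY').pow_const α)).comp measurable_swap).aemeasurable
      _ ≤ ∫⁻ _θ, B ∂κ := by
          refine lintegral_mono fun θ => ?_
          simp_rw [heq]
          exact hB θ
      _ = _ := by simp

end Convexity

/-! ### Mixtures of subsampled Gaussian pairs. -/

section Mixtures

variable {d : ℕ} {v x : ℝ}

lemma shiftDensity_le (hv : 0 < v) (a y : EuclideanSpace ℝ (Fin d)) :
    shiftDensity v a y ≤ Real.exp (‖y‖ ^ 2 / (2 * v)) := by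
  refine Real.exp_le_exp.2 ?_
  have h := real_inner_le_norm a y
  rw [div_sub_div _ _ hv.ne' (by positivity), div_le_div_iff₀ (by positivity) (by positivity)]
  have h2 : 2 * inner ℝ a y - ‖a‖ ^ 2 ≤ ‖y‖ ^ 2 := by nlinarith [sq_nonneg (‖a‖ - ‖y‖)]
  have h3 : 0 < v * v := by positivity
  nlinarith

lemma measurable_mixDensity {Θ : Type*} [MeasurableSpace Θ] (v γ : ℝ)
    {A B : Θ → EuclideanSpace ℝ (Fin d)} (hA : Measurable A) (hB : Measurable B) :
    Measurable fun p : Θ × EuclideanSpace ℝ (Fin d) => mixDensity v γ (A p.1) (B p.1) p.2 := by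
  unfold mixDensity shiftDensity
  fun_prop

/-- The Rényi bound for mixtures of subsampled Gaussian mechanisms. -/
lemma renyiBound_mixture {Θ : Type*} [MeasurableSpace Θ] (κ : Measure Θ) [IsProbabilityMeasure κ]
    (hv : 0 < v) {γ α : ℝ} (hγ : 0 ≤ γ) (hγ1 : γ ≤ 1) (hα : 1 < α)
    {A B C : Θ → EuclideanSpace ℝ (Fin d)} (hA : Measurable A) (hB : Measurable B)
    (hC : Measurable C) (hx : 0 < x) (hx1 : x ≤ 10 / 7)
    (hab : ∀ θ, ‖B θ - A θ‖ ^ 2 / v ≤ x) (hac : ∀ θ, ‖C θ - A θ‖ ^ 2 / v ≤ x)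
    (hbc : ∀ θ, ‖B θ - C θ‖ ^ 2 / v ≤ x)
    (hγα : γ * α * (1 + x) ≤ x * Real.exp (-(1.5 * (α - 1) * x))) :
    RenyiBound α
      ((noise d v).withDensity fun y => ∫⁻ θ, ENNReal.ofReal (mixDensity v γ (A θ) (B θ) y) ∂κ)
      ((noise d v).withDensity fun y => ∫⁻ θ, ENNReal.ofReal (mixDensity v γ (A θ) (C θ) y) ∂κ)
      (ENNReal.ofReal (Real.exp (3.5 * α * (α - 1) * γ ^ 2 * x))) := by
  refine renyiBound_withDensity_mixture κ (noise d v) hα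
    (X := fun θ y => mixDensity v γ (A θ) (B θ) y) (Y := fun θ y => mixDensity v γ (A θ) (C θ) y)
    (measurable_mixDensity v γ hA hB) (measurable_mixDensity v γ hA hC)
    (fun θ y => mixDensity_pos hγ hγ1 _ _ _) (fun θ y => mixDensity_pos hγ hγ1 _ _ _)
    (M := fun y => Real.exp (‖y‖ ^ 2 / (2 * v))) (fun θ y => ?_)
    fun θ => lintegral_mixDensity_le_exp hv hγ hγ1 hα hx hx1 (hab θ) (hac θ) (hbc θ) hγα
  have h1 := shiftDensity_le hv (A θ) y
  have h2 := shiftDensity_le hv (C θ) y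
  unfold mixDensity
  nlinarith

end Mixtures

/-! ### Coupling of samples with and without a given record. -/

section Subsampling

/-- Drawing a subset of size `k + 1` of `insert j s`, decomposed according to whether it contains
`j`: both parts are images of a uniform pair of a subset `R ⊆ s` of size `k` and an element of
`s \ R`. -/
lemma sum_powersetCard_insert {A : Type*} [DecidableEq A] {s : Finset A} {j : A} (hj : j ∉ s)
    {k : ℕ} (hk : k < s.card) {γ : ℝ} (hγ : γ = (k + 1) / (s.card + 1)) (h : Finset A → ℝ≥0∞) :
    (((insert j s).powersetCard (k + 1)).card : ℝ≥0∞)⁻¹ *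
        ∑ S ∈ (insert j s).powersetCard (k + 1), h S =
      (((s.powersetCard k).sigma fun R => s \ R).card : ℝ≥0∞)⁻¹ *
        ∑ p ∈ (s.powersetCard k).sigma fun R => s \ R,
          (ENNReal.ofReal (1 - γ) * h (insert p.2 p.1) +
            ENNReal.ofReal γ * h (insert j p.1)) := by
  have hsub : ∀ R ∈ s.powersetCard k, (s \ R).card = s.card - k := fun R hR => by
    obtain ⟨hR1, hR2⟩ := Finset.mem_powersetCard.1 hR
    rw [Finset.card_sdiff_of_subset hR1, hR2]
  have hcardI : ((s.powersetCard k).sigma fun R => s \ R).card =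
      s.card.choose k * (s.card - k) := by
    rw [Finset.card_sigma, Finset.sum_congr rfl hsub, Finset.sum_const, Finset.card_powersetCard,
      smul_eq_mul]
  have hcardM : ((insert j s).powersetCard (k + 1)).card = (s.card + 1).choose (k + 1) := by
    rw [Finset.card_powersetCard, Finset.card_insert_of_notMem hj]
  have hsplit : ∑ S ∈ (insert j s).powersetCard (k + 1), h S =
      ∑ S ∈ s.powersetCard (k + 1), h S + ∑ R ∈ s.powersetCard k, h (insert j R) := by
    rw [Finset.powersetCard_succ_insert hj, Finset.sum_union, Finset.sum_image]
    · intro R hR R' hR' hRR'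
      have hjR : j ∉ R := fun hm => hj ((Finset.mem_powersetCard.1 hR).1 hm)
      have hjR' : j ∉ R' := fun hm => hj ((Finset.mem_powersetCard.1 hR').1 hm)
      rw [← Finset.erase_insert hjR, ← Finset.erase_insert hjR', hRR']
    · rw [Finset.disjoint_left]
      intro S hS hS'
      obtain ⟨R, -, rfl⟩ := Finset.mem_image.1 hS'
      exact hj ((Finset.mem_powersetCard.1 hS).1 (Finset.mem_insert_self j R))
  have hin : ∑ p ∈ (s.powersetCard k).sigma fun R => s \ R, h (insert j p.1) =
      ((s.card - k : ℕ) : ℝ≥0∞) * ∑ R ∈ s.powersetCard k, h (insert j R) := by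
    rw [Finset.sum_sigma, Finset.mul_sum]
    refine Finset.sum_congr rfl fun R hR => ?_
    simp only
    rw [Finset.sum_const, hsub R hR, nsmul_eq_mul]
  -- Double counting: each set of size `k + 1` arises from `k + 1` pairs, one for each choice of its
  -- distinguished element.
  have hout : ∑ p ∈ (s.powersetCard k).sigma fun R => s \ R, h (insert p.2 p.1) =
      ((k + 1 : ℕ) : ℝ≥0∞) * ∑ S ∈ s.powersetCard (k + 1), h S := by
    have hrhs : ((k + 1 : ℕ) : ℝ≥0∞) * ∑ S ∈ s.powersetCard (k + 1), h S =
        ∑ p ∈ (s.powersetCard (k + 1)).sigma fun S => S, h p.1 := by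
      rw [Finset.sum_sigma, Finset.mul_sum]
      refine Finset.sum_congr rfl fun S hS => ?_
      simp only
      rw [Finset.sum_const, (Finset.mem_powersetCard.1 hS).2, nsmul_eq_mul]
    rw [hrhs]
    refine Finset.sum_bij' (fun p _ => ⟨insert p.2 p.1, p.2⟩) (fun p _ => ⟨p.1.erase p.2, p.2⟩)
      ?_ ?_ ?_ ?_ ?_
    · rintro ⟨R, l⟩ hp
      simp only [Finset.mem_sigma, Finset.mem_powersetCard, Finset.mem_sdiff] at hp ⊢
      obtain ⟨⟨hR, hc⟩, hl, hlR⟩ := hp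
      exact ⟨⟨Finset.insert_subset hl hR, by rw [Finset.card_insert_of_notMem hlR, hc]⟩,
        Finset.mem_insert_self _ _⟩
    · rintro ⟨S, l⟩ hp
      simp only [Finset.mem_sigma, Finset.mem_powersetCard, Finset.mem_sdiff] at hp ⊢
      obtain ⟨⟨hS, hc⟩, hl⟩ := hp
      exact ⟨⟨(Finset.erase_subset _ _).trans hS, by rw [Finset.card_erase_of_mem hl, hc]; rfl⟩,
        hS hl, Finset.notMem_erase _ _⟩
    · rintro ⟨R, l⟩ hp
      simp only [Finset.mem_sigma, Finset.mem_sdiff] at hp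
      simp [Finset.erase_insert hp.2.2]
    · rintro ⟨S, l⟩ hp
      simp only [Finset.mem_sigma] at hp
      simp [Finset.insert_erase hp.2]
    · intro p _
      rfl
  rw [hsplit, Finset.sum_add_distrib, ← Finset.mul_sum, ← Finset.mul_sum, hin, hout, hcardI,
    hcardM, mul_add, mul_add, ← mul_assoc, ← mul_assoc, ← mul_assoc, ← mul_assoc]
  have hr : (0 : ℝ) < s.card + 1 := by positivity
  have hks : (k : ℝ) < s.card := by exact_mod_cast hk
  have hid : ((s.card : ℝ) + 1) * (s.card.choose k : ℝ) =
      ((s.card + 1).choose (k + 1) : ℝ) * (k + 1) := by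
    exact_mod_cast Nat.add_one_mul_choose_eq s.card k
  have hch : (0 : ℝ) < (s.card.choose k : ℝ) := by exact_mod_cast Nat.choose_pos hk.le
  have hch' : (0 : ℝ) < ((s.card + 1).choose (k + 1) : ℝ) := by
    exact_mod_cast Nat.choose_pos (by omega)
  have hcast : ((s.card - k : ℕ) : ℝ) = s.card - k := by push_cast [hk.le]; ring
  have hpos : (0 : ℝ) < ((s.card.choose k * (s.card - k) : ℕ) : ℝ) := by
    rw [Nat.cast_mul, hcast]
    exact mul_pos hch (by linarith)
  have hinv : ∀ m : ℕ, (0 : ℝ) < m → (m : ℝ≥0∞)⁻¹ = ENNReal.ofReal ((m : ℝ)⁻¹) := fun m hm => by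
    rw [ENNReal.ofReal_inv_of_pos hm, ENNReal.ofReal_natCast]
  have hγ0 : 0 ≤ γ := by rw [hγ]; positivity
  have hγ1 : 1 - γ = (s.card - k) / (s.card + 1) := by rw [hγ]; field_simp; ring
  have hγ1' : 0 ≤ 1 - γ := by rw [hγ1]; exact div_nonneg (by linarith) hr.le
  have hne : (s.card : ℝ) - k ≠ 0 := by linarith
  congr 2
  · rw [hinv _ hch', hinv _ hpos, ← ENNReal.ofReal_natCast (k + 1), mul_assoc,
      ← ENNReal.ofReal_mul hγ1', ← ENNReal.ofReal_mul (inv_nonneg.2 hpos.le), hγ1]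
    congr 1
    push_cast
    rw [hcast]
    field_simp
    linarith
  · rw [hinv _ hch', hinv _ hpos, ← ENNReal.ofReal_natCast (s.card - k), mul_assoc,
      ← ENNReal.ofReal_mul hγ0, ← ENNReal.ofReal_mul (inv_nonneg.2 hpos.le), hγ]
    congr 1
    push_cast
    rw [hcast]
    field_simp
    linarith

end Subsampling

/-! ### The law of one privatized message. -/

lemma norm_sub_sq_div_le {Ω X : Type*} {d : ℕ} {v : ℝ}
    {f : Ω → Multiset X → EuclideanSpace ℝ (Fin d)} {C : ℝ} (hv : 0 < v) (hC : 0 < C)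
    (hfC : l2Sensitivity f ≤ ENNReal.ofReal (2 * C)) (ω : Ω) {s s' : Multiset X}
    (hs : NeighbouringSamples s s') :
    ‖f ω s - f ω s'‖ ^ 2 / v ≤ 4 * C ^ 2 / v := by
  have h : edist (f ω s) (f ω s') ≤ ENNReal.ofReal (2 * C) := by
    refine le_trans ?_ hfC
    rw [l2Sensitivity]
    exact le_iSup_of_le ω (le_iSup_of_le s (le_iSup_of_le s' (le_iSup_of_le hs le_rfl)))
  rw [edist_dist, ENNReal.ofReal_le_ofReal_iff (by positivity), dist_eq_norm] at h
  have h2 : ‖f ω s - f ω s'‖ ^ 2 ≤ 4 * C ^ 2 := by nlinarith [norm_nonneg (f ω s - f ω s')]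
  gcongr

section MessageLaw

variable {Ω X : Type*} [MeasurableSpace Ω] {n d : ℕ} {γ₁ v : ℝ} {ν : Measure Ω}
  [IsProbabilityMeasure ν] {f : Ω → Multiset X → EuclideanSpace ℝ (Fin d)}

lemma measurable_ofReal_shiftDensity {Θ : Type*} [MeasurableSpace Θ] (v : ℝ)
    {A : Θ → EuclideanSpace ℝ (Fin d)} (hA : Measurable A) :
    Measurable fun p : Θ × EuclideanSpace ℝ (Fin d) =>
      ENNReal.ofReal (shiftDensity v (A p.1) p.2) := by
  unfold shiftDensity
  fun_prop

lemma measurable_ofReal_shiftDensity_left {Θ : Type*} [MeasurableSpace Θ] (v : ℝ)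
    {A : Θ → EuclideanSpace ℝ (Fin d)} (hA : Measurable A) (y : EuclideanSpace ℝ (Fin d)) :
    Measurable fun θ => ENNReal.ofReal (shiftDensity v (A θ) y) := by
  unfold shiftDensity
  fun_prop

lemma measurable_ofReal_mixDensity_left {Θ : Type*} [MeasurableSpace Θ] (v γ : ℝ)
    {A B : Θ → EuclideanSpace ℝ (Fin d)} (hA : Measurable A) (hB : Measurable B)
    (y : EuclideanSpace ℝ (Fin d)) :
    Measurable fun θ => ENNReal.ofReal (mixDensity v γ (A θ) (B θ) y) := by
  unfold mixDensity shiftDensity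
  fun_prop

/-- Conditionally on `ω` the message is shifted noise; Tonelli averages the shift densities. -/
lemma map_add_noise_eq_withDensity (hv : 0 < v) {A : Ω → EuclideanSpace ℝ (Fin d)}
    (hA : Measurable A) :
    (ν.prod (noise d v)).map (fun p => A p.1 + p.2) =
      (noise d v).withDensity fun y => ∫⁻ ω, ENNReal.ofReal (shiftDensity v (A ω) y) ∂ν := by
  have hsum : Measurable fun p : Ω × EuclideanSpace ℝ (Fin d) => A p.1 + p.2 := by fun_prop
  ext s hs
  have hmeas : Measurable (Function.uncurry fun (y : EuclideanSpace ℝ (Fin d)) (ω : Ω) =>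
      ENNReal.ofReal (shiftDensity v (A ω) y)) := by
    unfold shiftDensity Function.uncurry
    fun_prop
  rw [Measure.map_apply hsum hs, Measure.prod_apply (hsum hs), withDensity_apply _ hs,
    lintegral_lintegral_swap hmeas.aemeasurable]
  refine lintegral_congr fun ω => ?_
  rw [← withDensity_apply _ hs, ← noise_map_const_add hv,
    Measure.map_apply (measurable_const_add _) hs]
  rfl

/-- The density of a privatized message generated from the sample `s`. -/
noncomputable def sampleDensity (v : ℝ) (ν : Measure Ω)
    (f : Ω → Multiset X → EuclideanSpace ℝ (Fin d)) (s : Multiset X)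
    (y : EuclideanSpace ℝ (Fin d)) : ℝ≥0∞ :=
  ∫⁻ ω, ENNReal.ofReal (shiftDensity v (f ω s) y) ∂ν

lemma measurable_sampleDensity (hf : ∀ s, Measurable fun ω => f ω s) (s : Multiset X) :
    Measurable (sampleDensity v ν f s) :=
  (measurable_ofReal_shiftDensity v (hf s)).lintegral_prod_left'

lemma messageLaw_eq_withDensity (hv : 0 < v) (hf : ∀ s, Measurable fun ω => f ω s)
    (J : Finset (Fin n)) (D : Fin n → X) :
    messageLaw γ₁ v ν f J D = (noise d v).withDensity fun y =>
      ((J.powersetCard ⌊γ₁ * (J.card : ℝ)⌋₊).card : ℝ≥0∞)⁻¹ *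
        ∑ S ∈ J.powersetCard ⌊γ₁ * (J.card : ℝ)⌋₊, sampleDensity v ν f (S.val.map D) y := by
  have hm : ∀ S : Finset (Fin n), Measurable (sampleDensity v ν f (S.val.map D)) := fun S =>
    measurable_sampleDensity hf _
  rw [messageLaw, uniformMixture_congr fun S _ => map_add_noise_eq_withDensity hv (hf _)]
  ext s hs
  rw [withDensity_apply _ hs, lintegral_const_mul _ (Finset.measurable_fun_sum _ fun S _ => hm S),
    lintegral_finsetSum _ fun S _ => hm S, uniformMixture, Measure.smul_apply,
    Measure.finsetSum_apply, smul_eq_mul]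
  congr 1
  exact Finset.sum_congr rfl fun S _ => withDensity_apply _ hs

lemma isProbabilityMeasure_messageLaw (hγ₁ : γ₁ ∈ Set.Ioo (0 : ℝ) 1)
    (hf : ∀ s, Measurable fun ω => f ω s) (J : Finset (Fin n)) (D : Fin n → X) :
    IsProbabilityMeasure (messageLaw γ₁ v ν f J D) := by
  refine isProbabilityMeasure_uniformMixture ?_ _ fun S _ => ?_
  · rw [Finset.powersetCard_nonempty]
    refine Nat.floor_le_of_le ?_
    have : (0 : ℝ) ≤ J.card := by positivity
    nlinarith [hγ₁.2]
  · have := hf (S.val.map D)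
    exact Measure.isProbabilityMeasure_map (by fun_prop)

/-- The Rényi bound for one privatized message. -/
lemma renyiBound_messageLaw {C α : ℝ} (hv : 0 < v) (hγ₁ : γ₁ ∈ Set.Ioo (0 : ℝ) 1)
    (hf : ∀ s, Measurable fun ω => f ω s) (hC : 0 < C)
    (hfC : l2Sensitivity f ≤ ENNReal.ofReal (2 * C)) (hα : 1 < α)
    (hx1 : 4 * C ^ 2 / v ≤ 10 / 7)
    (hγα : γ₁ * α * (1 + 4 * C ^ 2 / v) ≤
      4 * C ^ 2 / v * Real.exp (-(1.5 * (α - 1) * (4 * C ^ 2 / v))))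
    (J : Finset (Fin n)) {D D' : Fin n → X} (hD : Neighbouring D D') :
    RenyiBound α (messageLaw γ₁ v ν f J D) (messageLaw γ₁ v ν f J D')
      (ENNReal.ofReal (Real.exp (3.5 * α * (α - 1) * γ₁ ^ 2 * (4 * C ^ 2 / v)))) := by
  set x := 4 * C ^ 2 / v with hx
  have hx0 : 0 < x := by positivity
  obtain ⟨j, hj⟩ := hD
  have hmap : ∀ S : Finset (Fin n), j ∉ S → S.val.map D = S.val.map D' := fun S hS =>
    Multiset.map_congr rfl fun l hl => hj l fun h => hS (h ▸ hl)
  -- If no sample can contain the changed record, the two laws coincide.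
  by_cases htriv : ∀ S ∈ J.powersetCard ⌊γ₁ * (J.card : ℝ)⌋₊, j ∉ S
  · have heq : messageLaw γ₁ v ν f J D = messageLaw γ₁ v ν f J D' :=
      uniformMixture_congr fun S hS => by rw [hmap S (htriv S hS)]
    have := isProbabilityMeasure_messageLaw (v := v) (ν := ν) hγ₁ hf J D'
    rw [heq]
    refine (RenyiBound.refl α _).mono ?_
    rw [← ENNReal.ofReal_one]
    refine ENNReal.ofReal_le_ofReal (Real.one_le_exp ?_)
    have : 0 ≤ α * (α - 1) := mul_nonneg (by linarith) (by linarith)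
    have : 0 ≤ α * (α - 1) * (γ₁ ^ 2 * x) := by positivity
    linarith
  · push Not at htriv
    obtain ⟨S₀, hS₀, hjS₀⟩ := htriv
    obtain ⟨hS₀J, hS₀c⟩ := Finset.mem_powersetCard.1 hS₀
    obtain ⟨k, hk⟩ : ∃ k, ⌊γ₁ * (J.card : ℝ)⌋₊ = k + 1 :=
      Nat.exists_eq_succ_of_ne_zero (by rw [← hS₀c]; exact (Finset.card_pos.2 ⟨j, hjS₀⟩).ne')
    obtain ⟨s, hjs, rfl⟩ : ∃ s : Finset (Fin n), j ∉ s ∧ J = insert j s :=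
      ⟨J.erase j, Finset.notMem_erase j J, (Finset.insert_erase (hS₀J hjS₀)).symm⟩
    have hJc : ((insert j s).card : ℝ) = s.card + 1 := by
      rw [Finset.card_insert_of_notMem hjs, Nat.cast_add_one]
    have hfl : ((k : ℝ) + 1) ≤ γ₁ * (s.card + 1) := by
      have := Nat.floor_le (a := γ₁ * ((insert j s).card : ℝ))
        (mul_nonneg hγ₁.1.le (by positivity))
      rw [hk, hJc] at this
      exact_mod_cast this
    have hks : k < s.card := by
      have : (k : ℝ) < s.card := by nlinarith [hγ₁.2]
      exact_mod_cast this
    -- The true probability that `j` is sampled; the floor makes it at most `γ₁`.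
    let γ : ℝ := (k + 1) / (s.card + 1)
    have hγ0 : 0 ≤ γ := by positivity
    have hγ : γ ≤ γ₁ := by
      simp only [γ]
      rw [div_le_iff₀ (by positivity)]
      exact hfl
    have hγ1 : γ ≤ 1 := hγ.trans hγ₁.2.le
    let I : Finset (Σ _ : Finset (Fin n), Fin n) := (s.powersetCard k).sigma fun R => s \ R
    have hI : I.Nonempty := by
      obtain ⟨R, hR⟩ := Finset.powersetCard_nonempty.2 hks.le
      obtain ⟨hR1, hR2⟩ := Finset.mem_powersetCard.1 hR
      obtain ⟨l, hl, hlR⟩ := Finset.exists_mem_notMem_of_card_lt_card (hR2.trans_lt hks)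
      exact ⟨⟨R, l⟩, Finset.mem_sigma.2 ⟨hR, Finset.mem_sdiff.2 ⟨hl, hlR⟩⟩⟩
    let _ : MeasurableSpace I := ⊤
    let κ : Measure (I × Ω) := (uniformMixture Finset.univ fun p : I => Measure.dirac p).prod ν
    have : Nonempty I := hI.to_subtype
    have : IsProbabilityMeasure (uniformMixture Finset.univ fun p : I => Measure.dirac p) :=
      isProbabilityMeasure_uniformMixture Finset.univ_nonempty _ fun p _ => inferInstance
    let A : I × Ω → EuclideanSpace ℝ (Fin d) := fun θ =>
      f θ.2 (D θ.1.1.2 ::ₘ θ.1.1.1.val.map D)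
    -- Only the value at `j` is taken from `D₀`; the rest is read from `D`, which agrees with it
    -- there. Thus both data sets share `κ` and `A`.
    let B : (Fin n → X) → I × Ω → EuclideanSpace ℝ (Fin d) := fun D₀ θ =>
      f θ.2 (D₀ j ::ₘ θ.1.1.1.val.map D)
    have mA : Measurable A := measurable_from_prod_countable_right fun p =>
      hf (D p.1.2 ::ₘ p.1.1.val.map D)
    have mB : ∀ D₀, Measurable (B D₀) := fun D₀ =>
      measurable_from_prod_countable_right fun p =>
      hf (D₀ j ::ₘ p.1.1.val.map D)
    have hdens : ∀ D₀ : Fin n → X, (∀ l, l ≠ j → D l = D₀ l) →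
        messageLaw γ₁ v ν f (insert j s) D₀ = (noise d v).withDensity fun y =>
          ∫⁻ θ, ENNReal.ofReal (mixDensity v γ (A θ) (B D₀ θ) y) ∂κ := by
      intro D₀ hD₀
      rw [messageLaw_eq_withDensity hv hf]
      congr 1
      funext y
      have hmix := sum_powersetCard_insert hjs hks (γ := γ) rfl fun S =>
        sampleDensity v ν f (S.val.map D₀) y
      rw [hk, hmix]
      have mmix : Measurable fun θ => ENNReal.ofReal (mixDensity v γ (A θ) (B D₀ θ) y) :=
        measurable_ofReal_mixDensity_left v γ mA (mB D₀) y
      simp only [κ]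
      rw [lintegral_prod _ mmix.aemeasurable, lintegral_uniformMixture, Finset.card_univ,
        Fintype.card_coe]
      congr 1
      rw [← Finset.sum_coe_sort]
      refine Finset.sum_congr rfl fun p _ => ?_
      rw [lintegral_dirac]
      obtain ⟨⟨R, l⟩, hp⟩ := p
      obtain ⟨hR, hl⟩ := Finset.mem_sigma.1 hp
      obtain ⟨hl, hlR⟩ := Finset.mem_sdiff.1 hl
      have hRs := (Finset.mem_powersetCard.1 hR).1
      have hjR : j ∉ R := fun h => hjs (hRs h)
      have hlj : l ≠ j := fun h => hjs (h ▸ hl)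
      have hRD : R.val.map D = R.val.map D₀ :=
        Multiset.map_congr rfl fun i hi => hD₀ i fun h => hjR (h ▸ hi)
      simp only [A, B, mixDensity, Finset.insert_val_of_notMem hlR,
        Finset.insert_val_of_notMem hjR, Multiset.map_cons, sampleDensity, hRD, hD₀ l hlj]
      have m1 : ∀ s', Measurable fun ω => ENNReal.ofReal (shiftDensity v (f ω s') y) := fun s' =>
        measurable_ofReal_shiftDensity_left v (hf s') y
      rw [← lintegral_const_mul _ (m1 _), ← lintegral_const_mul _ (m1 _),
        ← lintegral_add_left ((m1 _).const_mul _)]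
      refine lintegral_congr fun ω => ?_
      have p1 := (shiftDensity_pos v (f ω (D₀ l ::ₘ R.val.map D₀)) y).le
      have p2 := (shiftDensity_pos v (f ω (D₀ j ::ₘ R.val.map D₀)) y).le
      rw [ENNReal.ofReal_add (mul_nonneg (by linarith) p1) (mul_nonneg hγ0 p2),
        ENNReal.ofReal_mul (by linarith), ENNReal.ofReal_mul hγ0]
    rw [hdens D fun _ _ => rfl, hdens D' hj]
    have hγα' : γ * α * (1 + x) ≤ x * Real.exp (-(1.5 * (α - 1) * x)) := by
      refine le_trans ?_ hγα
      gcongr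
    refine (renyiBound_mixture κ hv hγ0 hγ1 hα mA (mB D) (mB D') hx0 hx1 (fun θ => ?_)
      (fun θ => ?_) (fun θ => ?_) hγα').mono ?_
    -- All three samples consist of `R` and one further record, so any two differ by a single
    -- replacement.
    · exact norm_sub_sq_div_le hv hC hfC _ ⟨_, _, _, rfl, rfl⟩
    · exact norm_sub_sq_div_le hv hC hfC _ ⟨_, _, _, rfl, rfl⟩
    · exact norm_sub_sq_div_le hv hC hfC _ ⟨_, _, _, rfl, rfl⟩
    · refine ENNReal.ofReal_le_ofReal (Real.exp_le_exp.2 ?_)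
      have : 0 ≤ 3.5 * α * (α - 1) := mul_nonneg (by linarith) (by linarith)
      gcongr

end MessageLaw

/-! ### Assembly: privacy budget and choice of parameters. -/

/-- A mechanism whose outputs on neighbouring datasets satisfy a suitable Rényi bound whenever
`δ < 1` is differentially private. -/
lemma isDP_of_renyiBound {n : ℕ} {X Y : Type*} [MeasurableSpace Y]
    {M : (Fin n → X) → Measure Y} (hM : ∀ D, IsProbabilityMeasure (M D)) {ε δ α : ℝ}
    {B : ℝ≥0∞}
    (h : δ < 1 → 1 < α ∧ B ≤ ENNReal.ofReal (Real.exp ((α - 1) * ε) * δ) ∧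
      ∀ D D', Neighbouring D D' → RenyiBound α (M D) (M D') B) :
    IsDP M ε δ := by
  refine ⟨hM, fun D D' hD S hS => ?_⟩
  rcases lt_or_ge δ 1 with hδ | hδ
  · obtain ⟨hα, hB, hR⟩ := h hδ
    exact (hR D D' hD).measure_le hα hB S hS
  · calc M D S ≤ 1 := prob_le_one
      _ ≤ ENNReal.ofReal δ := by rwa [ENNReal.one_le_ofReal]
      _ ≤ _ := le_add_self

end DPMAC

open DPMAC in
theorem mainTheorem2 {Ω X : Type*} [MeasurableSpace Ω] (ν : Measure Ω) [IsProbabilityMeasure ν]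
    {N n d T : ℕ} (i : Fin N)
    (f : Fin T → Ω → Multiset X → EuclideanSpace ℝ (Fin d))
    (hf : ∀ t s, Measurable fun ω => f t ω s)
    (τ : Fin T → Finset (Fin n))
    (γ₁ γ₂ C ε δ α β σsq σsq' : ℝ)
    (hγ₁ : γ₁ ∈ Set.Ioo (0 : ℝ) 1) (hγ₂ : γ₂ ∈ Set.Ioo (0 : ℝ) 1)
    (hC : 0 < C) (hfC : ∀ t, DPMAC.l2Sensitivity (f t) ≤ ENNReal.ofReal (2 * C))
    (hε : 0 < ε) (hδ : 0 < δ) (hβ : β ∈ Set.Ioo (0 : ℝ) 1)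
    (hα : α = Real.log (δ⁻¹) / (ε * (1 - β)) + 1)
    (hσ : σsq = 14 * γ₂ * γ₁ ^ 2 * N * C ^ 2 * α * T / (β * ε))
    (hσ' : σsq' = σsq / (4 * C ^ 2)) (hσ'_ge : 0.7 ≤ σsq')
    (hα_le : α ≤ 2 * σsq' * Real.log (1 / (γ₁ * α * (1 + σsq'))) / 3 + 1) :
    DPMAC.IsDP (DPMAC.episodeFresh γ₁ γ₂ σsq ν i f τ) ε δ ∧
      DPMAC.IsDP (DPMAC.episodeShared γ₁ γ₂ σsq ν i f τ) ε δ := by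
  have hs0 : 0 < σsq' := by linarith
  have hσeq : σsq = σsq' * (4 * C ^ 2) := by rw [hσ']; field_simp
  have hv : 0 < σsq := by rw [hσeq]; positivity
  have hx : 4 * C ^ 2 / σsq = σsq'⁻¹ := by rw [hσeq]; field_simp
  have hmsg : ∀ t D, IsProbabilityMeasure (messageLaw γ₁ σsq ν (f t) (τ t) D) := fun t D =>
    isProbabilityMeasure_messageLaw hγ₁ (hf t) (τ t) D
  have hfresh : ∀ t D,
      IsProbabilityMeasure (stepFresh γ₂ i (messageLaw γ₁ σsq ν (f t) (τ t) D)) := fun t D =>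
    isProbabilityMeasure_stepFresh hγ₂ i _
  have hshared : ∀ t D,
      IsProbabilityMeasure (stepShared γ₂ i (messageLaw γ₁ σsq ν (f t) (τ t) D)) := fun t D =>
    isProbabilityMeasure_stepShared hγ₂ i _
  set r : ℝ := 3.5 * α * (α - 1) * γ₁ ^ 2 * (4 * C ^ 2 / σsq) with hr
  set B : ENNReal := ENNReal.ofReal (Real.exp r) with hB
  have key : δ < 1 → 1 < α ∧ ∏ _t : Fin T, B ^ ⌊γ₂ * (N : ℝ)⌋₊ ≤
        ENNReal.ofReal (Real.exp ((α - 1) * ε) * δ) ∧ 1 ≤ B ∧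
        ∀ D D', Neighbouring D D' → ∀ t, RenyiBound α (messageLaw γ₁ σsq ν (f t) (τ t) D)
          (messageLaw γ₁ σsq ν (f t) (τ t) D') B := by
    intro hδ1
    have hlog : 0 < Real.log δ⁻¹ := Real.log_pos ((one_lt_inv₀ hδ).2 hδ1)
    have hβ' : 0 < 1 - β := by linarith [hβ.2]
    have hα1 : 1 < α := by
      rw [hα]
      have : 0 < Real.log δ⁻¹ / (ε * (1 - β)) := by positivity
      linarith
    have hr0 : 0 ≤ r := by
      have : 0 ≤ 3.5 * α * (α - 1) := mul_nonneg (by linarith) (by linarith)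
      positivity
    refine ⟨hα1, ?_, ?_, fun D D' hD t => ?_⟩
    -- This is the choice of `α`: it turns the allowed moment `exp ((α-1) ε) δ` into `exp ((α-1) β
    -- ε)`.
    · have hδexp : δ = Real.exp (-((α - 1) * (ε * (1 - β)))) := by
        have : (α - 1) * (ε * (1 - β)) = Real.log δ⁻¹ := by
          rw [hα, add_sub_cancel_right]
          field_simp
        rw [this, Real.log_inv, neg_neg, Real.exp_log hδ]
      rw [Finset.prod_const, Finset.card_univ, Fintype.card_fin, ← pow_mul, hB,
        ← ENNReal.ofReal_pow (Real.exp_pos _).le]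
      refine ENNReal.ofReal_le_ofReal ?_
      conv_rhs => rw [hδexp]
      rw [← Real.exp_nat_mul, ← Real.exp_add]
      refine Real.exp_le_exp.2 ?_
      have hfl : (⌊γ₂ * (N : ℝ)⌋₊ : ℝ) ≤ γ₂ * N :=
        Nat.floor_le (mul_nonneg hγ₂.1.le (by positivity))
      have hβ0 := hβ.1
      have hσs : σsq * (β * ε) = 14 * γ₂ * γ₁ ^ 2 * N * C ^ 2 * α * T := by
        rw [hσ]; field_simp
      -- The `14` in the variance is `3.5 · 4`, and the variance is chosen to make this an equality.
      have hbudget : γ₂ * N * T * r = (α - 1) * (β * ε) := by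
        have : γ₂ * N * T * r * σsq = (α - 1) * (β * ε) * σsq := by
          rw [hr, mul_assoc (α - 1), mul_comm (β * ε), hσs]
          field_simp
          ring
        exact mul_right_cancel₀ hv.ne' this
      push_cast
      calc (⌊γ₂ * (N : ℝ)⌋₊ : ℝ) * T * r ≤ γ₂ * N * T * r := by gcongr
        _ = _ := by rw [hbudget]; ring
    · rw [hB, ENNReal.one_le_ofReal]
      exact Real.one_le_exp hr0
    · refine renyiBound_messageLaw hv hγ₁ (hf t) hC (hfC t) hα1 ?_ ?_ (τ t) hD
      · rw [hx, inv_le_comm₀ hs0 (by norm_num)]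
        linarith
      · rw [hx]
        have hp : 0 < γ₁ * α * (1 + σsq') := by
          have := hγ₁.1
          positivity
        rw [one_div, Real.log_inv] at hα_le
        -- The upper bound on `α`, solved for the logarithm; exponentiating and multiplying by `x =
        -- 1/σ'²` gives the smallness condition of the message bound.
        have hl : Real.log (γ₁ * α * (1 + σsq')) ≤ -(1.5 * (α - 1) * σsq'⁻¹) := by
          have h1 : 1.5 * (α - 1) ≤ σsq' * -Real.log (γ₁ * α * (1 + σsq')) := by linarith
          have h2 : 1.5 * (α - 1) * σsq'⁻¹ ≤ -Real.log (γ₁ * α * (1 + σsq')) := by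
            rw [← div_eq_mul_inv, div_le_iff₀ hs0]
            linarith
          linarith
        have h3 := (Real.log_le_iff_le_exp hp).1 hl
        calc γ₁ * α * (1 + σsq'⁻¹) = σsq'⁻¹ * (γ₁ * α * (1 + σsq')) := by field_simp; ring
          _ ≤ _ := by gcongr
  constructor
  · refine isDP_of_renyiBound (α := α) (B := ∏ _t : Fin T, B ^ ⌊γ₂ * (N : ℝ)⌋₊)
      (fun D => ?_) fun hδ1 => ?_
    · unfold episodeFresh; infer_instance
    · obtain ⟨hα1, hbud, -, hR⟩ := key hδ1
      exact ⟨hα1, hbud, fun D D' hD => RenyiBound.pi (by linarith) fun t =>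
        (hR D D' hD t).stepFresh hγ₂ (by linarith) i⟩
  · refine isDP_of_renyiBound (α := α) (B := ∏ _t : Fin T, B ^ ⌊γ₂ * (N : ℝ)⌋₊)
      (fun D => ?_) fun hδ1 => ?_
    · unfold episodeShared; infer_instance
    · obtain ⟨hα1, hbud, hB1, hR⟩ := key hδ1
      exact ⟨hα1, hbud, fun D D' hD => RenyiBound.pi (by linarith) fun t =>
        (hR D D' hD t).stepShared hγ₂ hB1 i⟩
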